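/- Let $I\subset\mathbb R$ be an interval and let $\rho(t,x)$, $t\in I$, $x\in\mathbb R$, be real and positive, such that $t\mapsto\rho(t,\cdot)-1$ is a continuous curve in the Schwartz space $\mathcal S(\mathbb R)$ and $\rho$ solves the Harry Dym equation $$(\rho^2)_t=\tfrac12 D^3\Big(\frac1\rho\Big),\qquad D=\frac{\partial}{\partial x},$$ pointwise on $I\times\mathbb R$ (with one-sided time derivatives at end points belonging to $I$). For $t\in I$ put $S(x,t)=x+\int_{-\infty}^x(\rho(t,y)-1)\,dy$. Let $\varphi_+(x,t,k)$, $\psi_+(x,t,k)$ ($\operatorname{Im}k\ge 0$) and $\psi_-(x,t,k)$ ($k$ real) be the solutions of the acoustic equation $(D^2+k^2\rho(t,x)^2)\psi=0$, $-\infty<x<\infty$, normalized by $$\lim_{x\to-\infty}e^{ikS}\varphi_+=1,\qquad \lim_{x\to+\infty}e^{\mp ikS}\psi_\pm=1 .$$ For real $k\neq0$ let the scattering data $a(k,t),b(k,t)$ be defined by $$\varphi_+(x,t,k)=a(k,t)\,\psi_-(x,t,k)+b(k,t)\,\psi_+(x,t,k)\qquad(x\in\mathbb R),$$ and put $a(0,t)=1$,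 $b(0,t)=0$; for $\operatorname{Im}k>0$ let $a(k,t)$ be defined by $2ik\,a(k,t)=\varphi_+D\psi_+-\psi_+D\varphi_+$, the Wronskian on the right being independent of $x$. Then for every $t\in I$ these data exist and are uniquely determined by $\rho(t,\cdot)$, they are differentiable in $t$ on $I$, and $$\dot a(k,t)=0\quad(\operatorname{Im}k\ge0),\qquad \dot b(k,t)=2ik^3\,b(k,t)\quad(k\in\mathbb R).$$ -/

import Mathlib

open Filter Topology

noncomputable section

namespace Acoustic

/-- The travel time `S(x) = x + ∫_{-∞}^x (ρ(y) - 1) dy`. -/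
def travelTime (ρ : ℝ → ℝ) (x : ℝ) : ℝ :=
  x + ∫ y in Set.Iic x, (ρ y - 1)

/-- `ψ` is a (classical) solution on the line of the acoustic equation
`(D² + k² ρ²) ψ = 0` with complex frequency `k`. -/
def IsSolution (ρ : ℝ → ℝ) (k : ℂ) (ψ : ℝ → ℂ) : Prop :=
  Differentiable ℝ ψ ∧
    ∀ x : ℝ, HasDerivAt (deriv ψ) (-(k ^ 2 * (ρ x : ℂ) ^ 2 * ψ x)) x

/-- `φ` is the wave function `φ₊(·, k)`: a solution such that
`e^{ikS(x)} φ(x) → 1` as `x → -∞`. -/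
def IsPhiPlus (ρ : ℝ → ℝ) (k : ℂ) (φ : ℝ → ℂ) : Prop :=
  IsSolution ρ k φ ∧
    Tendsto (fun x : ℝ => Complex.exp (Complex.I * k * (travelTime ρ x : ℂ)) * φ x)
      atBot (𝓝 1)

/-- `ψ` is the wave function `ψ₊(·, k)`: a solution such that
`e^{-ikS(x)} ψ(x) → 1` as `x → +∞`. -/
def IsPsiPlus (ρ : ℝ → ℝ) (k : ℂ) (ψ : ℝ → ℂ) : Prop :=
  IsSolution ρ k ψ ∧
    Tendsto (fun x : ℝ => Complex.exp (-(Complex.I * k * (travelTime ρ x : ℂ))) * ψ x)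
      atTop (𝓝 1)

/-- `ψ` is the wave function `ψ₋(·, k)`: a solution such that
`e^{ikS(x)} ψ(x) → 1` as `x → +∞`. -/
def IsPsiMinus (ρ : ℝ → ℝ) (k : ℂ) (ψ : ℝ → ℂ) : Prop :=
  IsSolution ρ k ψ ∧
    Tendsto (fun x : ℝ => Complex.exp (Complex.I * k * (travelTime ρ x : ℂ)) * ψ x)
      atTop (𝓝 1)

/-- `(α, β)` is the value `(a(k), b(k))` of the scattering data of `ρ` at the real frequency `k`.
For `k ≠ 0` it is given by the connection formula `φ₊ = a ψ₋ + b ψ₊`. At `k = 0`, where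
`φ₊ = ψ₊ = ψ₋ = 1` and that formula does not determine `a` and `b`, the values are those of
the continuous extension, `a(0) = 1` and `b(0) = 0`. -/
def IsScatteringData (ρ : ℝ → ℝ) (k : ℝ) (α β : ℂ) : Prop :=
  (k = 0 ∧ α = 1 ∧ β = 0) ∨
  (k ≠ 0 ∧ ∃ φ ψp ψm : ℝ → ℂ,
    IsPhiPlus ρ k φ ∧ IsPsiPlus ρ k ψp ∧ IsPsiMinus ρ k ψm ∧
      ∀ x : ℝ, φ x = α * ψm x + β * ψp x)

/-- `α` is the value `a(k)` at a point `k ≠ 0` of the closed upper half plane of the extended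
coefficient `a`: the Wronskian `φ₊ ψ₊' - φ₊' ψ₊` is `2 i k a(k)`. -/
def IsExtendedA (ρ : ℝ → ℝ) (k α : ℂ) : Prop :=
  ∃ φ ψ : ℝ → ℂ, IsPhiPlus ρ k φ ∧ IsPsiPlus ρ k ψ ∧
    ∀ x : ℝ, φ x * deriv ψ x - deriv φ x * ψ x = 2 * Complex.I * k * α

/-- `ρ(t, x)`, `t ∈ I`, is a solution of the Harry Dym equation `(ρ²)_t = ½ D³(1/ρ)` in the
phase space of positive functions `ρ` with `ρ - 1` in the Schwartz class: `t ↦ ρ(t, ·) - 1` is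
a continuous curve in the Schwartz space, and the equation holds pointwise
(with a one-sided time derivative at an end point that belongs to `I`). -/
structure IsHarryDymFlow (I : Set ℝ) (ρ : ℝ → ℝ → ℝ) : Prop where
  pos : ∀ t ∈ I, ∀ x : ℝ, 0 < ρ t x
  schwartz : ∃ v : ℝ → SchwartzMap ℝ ℝ, ContinuousOn v I ∧
    ∀ t ∈ I, ∀ x : ℝ, v t x = ρ t x - 1
  equation : ∀ t ∈ I, ∀ x : ℝ,
    HasDerivWithinAt (fun s : ℝ => ρ s x ^ 2)
      ((1 / 2) * iteratedDeriv 3 (fun y : ℝ => 1 / ρ t y) x) I t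

end Acoustic

end

noncomputable section

open MeasureTheory Set

namespace Acoustic

/-! ### Integrals over right half-lines -/

/-! Put M = ∫ (ρ - 1), A = 1/ρ and W(f, g) = f g' - f' g. Since S(x) - x tends to 0 at -∞ and to M
at +∞, the functions φ₊, ψ₊, ψ₋ are 1, e^{ikM}, e^{-ikM} times the Jost solutions φ, ψ, χ normalised
by the plane waves e^{-ikx}, e^{ikx}, e^{-ikx} (`isPhiPlus_iff`, `isPsiPlus_iff`). Cramer's rule
gives a = e^{ikM} W(φ, ψ)/(2ik) and b = -e^{-ikM} W(φ, χ)/(2ik) (`isScatteringData_iff`,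
`isExtendedA_iff`). It remains to find how M and the two Wronskians evolve.

M is conserved: the flow gives ρ_t = ¼ A A''', and A A''' = (A A'' - ½ A'²)'.

For Wronskians, let κ = ±k be the frequency of the right Jost solution. For two potentials, W(φ₁,
ψ₂)' = k² (ρ₁² - ρ₂²) φ₁ ψ₂, and W(φ₁, ψ₂) tends to W(φ₂, ψ₂) at -∞ and to W(φ₁, ψ₁) at +∞
(`wronskian_sub_eq_integral`). Applying this to times t and s, dividing by t - s and letting t → s
gives W_t = (k²/2) ∫ A''' φψ. A product p = φψ of solutions satisfies p''' = -4k²ρ²p' - 2k²(ρ²)'p,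
so A p''' = -4k²(ρp)', and A'''p is the derivative of A''p - A'p' + Ap'' + 4k²ρp. Its boundary
values yield ∫ A''' φψ = 2i(k - κ)W (`integral_deriv_three_mul`), hence W_t = ik²(k - κ)W: this is 0
for κ = k and 2ik³W for κ = -k.

The limit t → s is by dominated convergence. It uses Jost solutions with bounds uniform over a class
of potentials and Lipschitz in ρ² (`exists_volterra_solution`, `exists_jostRight`), and bounds for
the flow that are uniform near s (`IsHarryDymFlow.exists_local_bounds`). No time derivative of a
Jost solution is needed. -/

theorem hasDerivAt_integral_Ioi {g : ℝ → ℂ} (hg : Continuous g)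
    (hi : ∀ x, IntegrableOn g (Ioi x)) (x : ℝ) :
    HasDerivAt (fun x => ∫ y in Ioi x, g y) (-g x) x := by
  have h : (fun x => ∫ y in Ioi x, g y) =
      fun x => (∫ y in Ioi (0 : ℝ), g y) - ∫ y in (0 : ℝ)..x, g y := by
    funext z
    rw [← intervalIntegral.integral_Ioi_sub_Ioi' (hi 0) (hi z)]
    ring
  rw [h]
  simpa using (intervalIntegral.integral_hasDerivAt_right (hg.intervalIntegrable 0 x)
    (hg.stronglyMeasurableAtFilter _ _) hg.continuousAt).const_sub (∫ y in Ioi (0 : ℝ), g y)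

theorem integrable_of_norm_le_inv_one_add_sq {E : Type*} [NormedAddCommGroup E] {g : ℝ → E}
    (hg : Continuous g) {D : ℝ} (h : ∀ x, ‖g x‖ ≤ D * (1 + x ^ 2)⁻¹) : Integrable g :=
  (integrable_inv_one_add_sq.const_mul D).mono' hg.aestronglyMeasurable (ae_of_all _ h)

/-- The kernel of the Volterra equation at the frequency `k`. -/
def volterraKernel (k : ℂ) (z : ℝ) : ℂ :=
  (Complex.exp (2 * Complex.I * k * z) - 1) / (2 * Complex.I * k)

/-- The half-line potential with kernel `volterraKernel k (y - x)`. -/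
def volterra (k : ℂ) (f : ℝ → ℂ) (x : ℝ) : ℂ :=
  ∫ y in Ioi x, volterraKernel k (y - x) * f y

/-- Minus the derivative of `volterra k f`. -/
def volterraDeriv (k : ℂ) (f : ℝ → ℂ) (x : ℝ) : ℂ :=
  ∫ y in Ioi x, Complex.exp (2 * Complex.I * k * ((y - x : ℝ) : ℂ)) * f y

theorem norm_exp_two_I_mul_le_one {k : ℂ} (hk : 0 ≤ k.im) {z : ℝ} (hz : 0 ≤ z) :
    ‖Complex.exp (2 * Complex.I * k * z)‖ ≤ 1 := by
  rw [Complex.norm_exp, Real.exp_le_one_iff]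
  simp
  positivity

theorem norm_volterraKernel_le {k : ℂ} (hk : 0 ≤ k.im) {z : ℝ} (hz : 0 ≤ z) :
    ‖volterraKernel k z‖ ≤ ‖k‖⁻¹ := by
  have h : ‖Complex.exp (2 * Complex.I * k * z) - 1‖ ≤ 2 :=
    (norm_sub_le _ _).trans (by
      have := norm_exp_two_I_mul_le_one hk hz
      rw [norm_one]; linarith)
  rw [volterraKernel, norm_div, norm_mul, norm_mul, Complex.norm_I, mul_one, Complex.norm_ofNat]
  calc _ ≤ 2 / (2 * ‖k‖) := by gcongr
    _ = ‖k‖⁻¹ := by rw [div_mul_eq_div_div, div_self two_ne_zero, one_div]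

theorem norm_volterra_le {k : ℂ} (hk : 0 ≤ k.im) {f : ℝ → ℂ} {g : ℝ → ℝ} {x : ℝ}
    (hg : IntegrableOn g (Ioi x)) (hfg : ∀ y, ‖f y‖ ≤ g y) :
    ‖volterra k f x‖ ≤ ‖k‖⁻¹ * ∫ y in Ioi x, g y := by
  rw [← integral_const_mul]
  refine norm_integral_le_of_norm_le (hg.const_mul _) ?_
  refine (ae_restrict_iff' measurableSet_Ioi).2 (ae_of_all _ fun y hy => ?_)
  rw [norm_mul]
  exact mul_le_mul (norm_volterraKernel_le hk (sub_nonneg.2 (le_of_lt hy))) (hfg y)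
    (norm_nonneg _) (by positivity)

theorem norm_volterraDeriv_le {k : ℂ} (hk : 0 ≤ k.im) {f : ℝ → ℂ} {g : ℝ → ℝ} {x : ℝ}
    (hg : IntegrableOn g (Ioi x)) (hfg : ∀ y, ‖f y‖ ≤ g y) :
    ‖volterraDeriv k f x‖ ≤ ∫ y in Ioi x, g y := by
  refine norm_integral_le_of_norm_le hg ?_
  refine (ae_restrict_iff' measurableSet_Ioi).2 (ae_of_all _ fun y hy => ?_)
  rw [norm_mul]
  exact (mul_le_of_le_one_left (norm_nonneg _)
    (norm_exp_two_I_mul_le_one hk (sub_nonneg.2 (le_of_lt hy)))).trans (hfg y)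

/-- As Im k ≥ 0, the exponential is largest in modulus at the left end point of the half-line. -/
theorem integrableOn_exp_mul {k : ℂ} (hk : 0 ≤ k.im) {f : ℝ → ℂ} (hf : Continuous f)
    (hi : Integrable f) (x : ℝ) :
    IntegrableOn (fun y : ℝ => Complex.exp (2 * Complex.I * k * y) * f y) (Ioi x) := by
  have hc : Continuous fun y : ℝ => Complex.exp (2 * Complex.I * k * y) * f y := by fun_prop
  refine ((hi.norm.const_mul ‖Complex.exp (2 * Complex.I * k * x)‖).integrableOn (s := Ioi x)).mono'
    hc.aestronglyMeasurable ?_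
  refine (ae_restrict_iff' measurableSet_Ioi).2 (ae_of_all _ fun y hy => ?_)
  have h1 := norm_exp_two_I_mul_le_one hk (sub_nonneg.2 (le_of_lt (mem_Ioi.1 hy)))
  rw [norm_mul]
  gcongr
  have : Complex.exp (2 * Complex.I * k * y) = Complex.exp (2 * Complex.I * k * x) *
      Complex.exp (2 * Complex.I * k * ((y - x : ℝ) : ℂ)) := by
    rw [← Complex.exp_add]; push_cast; ring_nf
  rw [this, norm_mul]
  exact mul_le_of_le_one_right (norm_nonneg _) h1

/-- Separates x from y in the kernel, so that the product rule and the fundamental theorem of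
calculus replace differentiation under the integral. -/
theorem volterraDeriv_eq (k : ℂ) (f : ℝ → ℂ) (x : ℝ) :
    volterraDeriv k f x = Complex.exp (-(2 * Complex.I * k * x)) *
      ∫ y in Ioi x, Complex.exp (2 * Complex.I * k * y) * f y := by
  rw [volterraDeriv, ← integral_const_mul]
  congr 1 with y
  rw [← mul_assoc, ← Complex.exp_add]
  push_cast
  ring_nf

theorem integrableOn_exp_sub_mul {k : ℂ} (hk : 0 ≤ k.im) {f : ℝ → ℂ} (hf : Continuous f)
    (hi : Integrable f) (x : ℝ) :
    IntegrableOn (fun y : ℝ => Complex.exp (2 * Complex.I * k * ((y - x : ℝ) : ℂ)) * f y)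
      (Ioi x) := by
  refine Integrable.congr ((integrableOn_exp_mul hk hf hi x).const_mul
    (Complex.exp (-(2 * Complex.I * k * x)))) (ae_of_all _ fun y => ?_)
  simp only
  rw [← mul_assoc, ← Complex.exp_add]
  push_cast
  ring_nf

theorem volterra_eq {k : ℂ} (hk : 0 ≤ k.im) {f : ℝ → ℂ} (hf : Continuous f)
    (hi : Integrable f) (x : ℝ) :
    volterra k f x = (volterraDeriv k f x - ∫ y in Ioi x, f y) / (2 * Complex.I * k) := by
  rw [volterraDeriv, ← integral_sub (integrableOn_exp_sub_mul hk hf hi x) hi.integrableOn,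
    volterra, ← integral_div]
  congr 1 with y
  rw [volterraKernel]
  ring

theorem integrableOn_volterraKernel_mul {k : ℂ} (hk : 0 ≤ k.im) {f : ℝ → ℂ} (hf : Continuous f)
    (hi : Integrable f) (x : ℝ) :
    IntegrableOn (fun y : ℝ => volterraKernel k (y - x) * f y) (Ioi x) := by
  refine Integrable.congr (((integrableOn_exp_sub_mul hk hf hi x).sub hi.integrableOn).div_const
    (2 * Complex.I * k)) (ae_of_all _ fun y => ?_)
  simp only [volterraKernel, Pi.sub_apply]
  ring

theorem volterra_sub {k : ℂ} (hk : 0 ≤ k.im) {f g : ℝ → ℂ} (hf : Continuous f)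
    (hfi : Integrable f) (hg : Continuous g) (hgi : Integrable g) (x : ℝ) :
    volterra k f x - volterra k g x = volterra k (fun y => f y - g y) x := by
  rw [volterra, volterra, volterra, ← integral_sub (integrableOn_volterraKernel_mul hk hf hfi x)
    (integrableOn_volterraKernel_mul hk hg hgi x)]
  simp only [mul_sub]

theorem hasDerivAt_volterraDeriv {k : ℂ} (hk : 0 ≤ k.im) {f : ℝ → ℂ} (hf : Continuous f)
    (hi : Integrable f) (x : ℝ) :
    HasDerivAt (volterraDeriv k f) (-(2 * Complex.I * k * volterraDeriv k f x) - f x) x := by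
  have h1 := hasDerivAt_integral_Ioi (g := fun y : ℝ => Complex.exp (2 * Complex.I * k * y) * f y)
    (by fun_prop) (integrableOn_exp_mul hk hf hi) x
  have h2 : HasDerivAt (fun x : ℝ => Complex.exp (-(2 * Complex.I * k * x)))
      (Complex.exp (-(2 * Complex.I * k * x)) * (-(2 * Complex.I * k * 1))) x :=
    (((hasDerivAt_id x).ofReal_comp.const_mul (2 * Complex.I * k)).neg).cexp
  have h3 := h2.mul h1
  rw [show volterraDeriv k f = _ from funext (volterraDeriv_eq k f)]
  refine h3.congr_deriv ?_
  have : Complex.exp (-(2 * Complex.I * k * x)) * Complex.exp (2 * Complex.I * k * x) = 1 := by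
    rw [← Complex.exp_add]; simp
  linear_combination -f x * this

theorem hasDerivAt_volterra {k : ℂ} (hk : 0 ≤ k.im) (hk0 : k ≠ 0) {f : ℝ → ℂ} (hf : Continuous f)
    (hi : Integrable f) (x : ℝ) :
    HasDerivAt (volterra k f) (-volterraDeriv k f x) x := by
  have h1 := ((hasDerivAt_volterraDeriv hk hf hi x).sub
    (hasDerivAt_integral_Ioi hf (fun z => hi.integrableOn) x)).div_const (2 * Complex.I * k)
  rw [show volterra k f = _ from funext (volterra_eq hk hf hi)]
  refine h1.congr_deriv ?_
  have := Complex.I_ne_zero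
  field_simp
  ring

/-! ### Solution of the Volterra equation -/

theorem hasDerivAt_exp_neg_mul_arctan (l x : ℝ) :
    HasDerivAt (fun y => Real.exp (-(l * Real.arctan y)))
      (-l * (Real.exp (-(l * Real.arctan x)) * (1 + x ^ 2)⁻¹)) x := by
  refine ((Real.hasDerivAt_arctan' x).const_mul l).neg.exp.congr_deriv ?_
  simp only [Pi.neg_apply]
  ring

theorem exp_neg_mul_arctan_le {l : ℝ} (hl : 0 ≤ l) (x : ℝ) :
    Real.exp (-(l * Real.arctan x)) ≤ Real.exp (l * (Real.pi / 2)) := by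
  refine Real.exp_le_exp.2 ?_
  have := Real.neg_pi_div_two_lt_arctan x
  nlinarith

theorem exp_mul_arctan_le {l : ℝ} (hl : 0 ≤ l) (x : ℝ) :
    Real.exp (l * Real.arctan x) ≤ Real.exp (l * (Real.pi / 2)) := by
  refine Real.exp_le_exp.2 ?_
  have := Real.arctan_lt_pi_div_two x
  nlinarith

theorem integrable_exp_neg_mul_arctan {l : ℝ} (hl : 0 ≤ l) :
    Integrable fun x => Real.exp (-(l * Real.arctan x)) * (1 + x ^ 2)⁻¹ := by
  refine integrable_of_norm_le_inv_one_add_sq (D := Real.exp (l * (Real.pi / 2))) ?_ fun x => ?_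
  · have : ∀ x : ℝ, 1 + x ^ 2 ≠ 0 := fun x => by positivity
    fun_prop (disch := assumption)
  · have h0 : 0 ≤ (1 + x ^ 2)⁻¹ := by positivity
    rw [Real.norm_of_nonneg (by positivity)]
    gcongr ?_ * _
    exact exp_neg_mul_arctan_le hl x

/-- The integrand is an exact derivative. The factor l⁻¹ gained here is what makes the weighted
Volterra operator a contraction, while the weight itself stays bounded above and below because
arctan is bounded. -/
theorem integral_Ioi_exp_neg_mul_arctan_le {l : ℝ} (hl : 0 < l) (x : ℝ) :
    ∫ y in Ioi x, Real.exp (-(l * Real.arctan y)) * (1 + y ^ 2)⁻¹ ≤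
      l⁻¹ * Real.exp (-(l * Real.arctan x)) := by
  have ht : Tendsto (fun y => -l⁻¹ * Real.exp (-(l * Real.arctan y))) atTop
      (𝓝 (-l⁻¹ * Real.exp (-(l * (Real.pi / 2))))) := by
    have := tendsto_nhds_of_tendsto_nhdsWithin Real.tendsto_arctan_atTop
    exact (((Real.continuous_exp.tendsto _).comp (this.const_mul l).neg)).const_mul _
  rw [integral_Ioi_of_hasDerivAt_of_tendsto' (f := fun y => -l⁻¹ * Real.exp (-(l * Real.arctan y)))
    (fun y _ => ?_) (integrable_exp_neg_mul_arctan hl.le).integrableOn ht]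
  · have : 0 ≤ l⁻¹ * Real.exp (-(l * (Real.pi / 2))) := by positivity
    linarith
  · convert! (hasDerivAt_exp_neg_mul_arctan l y).const_mul (-l⁻¹) using 1
    field_simp

theorem norm_exp_arctan_mul_volterra_le {k : ℂ} (hk : 0 ≤ k.im) {l D : ℝ} (hl : 0 < l)
    {f : ℝ → ℂ} (hD : 0 ≤ D)
    (hf : ∀ y, ‖f y‖ ≤ D * (Real.exp (-(l * Real.arctan y)) * (1 + y ^ 2)⁻¹)) (x : ℝ) :
    ‖(Real.exp (l * Real.arctan x) : ℂ) * volterra k f x‖ ≤ ‖k‖⁻¹ * D * l⁻¹ := by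
  have h1 := norm_volterra_le hk
    (((integrable_exp_neg_mul_arctan hl.le).const_mul D).integrableOn (s := Ioi x)) hf
  rw [integral_const_mul] at h1
  rw [norm_mul, Complex.norm_real, Real.norm_of_nonneg (Real.exp_pos _).le]
  calc _ ≤ Real.exp (l * Real.arctan x) *
        (‖k‖⁻¹ * (D * (l⁻¹ * Real.exp (-(l * Real.arctan x))))) := by
        gcongr
        exact h1.trans (by gcongr; exact integral_Ioi_exp_neg_mul_arctan_le hl x)
    _ = ‖k‖⁻¹ * D * l⁻¹ * (Real.exp (l * Real.arctan x) * Real.exp (-(l * Real.arctan x))) := by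
        ring
    _ = _ := by rw [← Real.exp_add]; simp

/-- The exponent of the weight for which the Volterra operator is a contraction. -/
def weightExp (k : ℂ) (C : ℝ) : ℝ := 2 * ‖k‖ * C + 1

theorem weightExp_pos (k : ℂ) {C : ℝ} (hC : 0 ≤ C) : 0 < weightExp k C := by
  unfold weightExp; positivity

/-- The source term of the weighted Volterra equation. -/
def weightedSource (k : ℂ) (C : ℝ) (u : ℝ → ℝ) (n : ℝ → ℂ) (y : ℝ) : ℂ :=
  k ^ 2 * (u y : ℂ) * ((Real.exp (-(weightExp k C * Real.arctan y)) : ℂ) * n y)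

theorem continuous_weightedSource (k : ℂ) (C : ℝ) {u : ℝ → ℝ} (hu : Continuous u) {n : ℝ → ℂ}
    (hn : Continuous n) : Continuous (weightedSource k C u n) := by
  unfold weightedSource
  fun_prop

theorem norm_weightedSource_sub_le (k : ℂ) {C e : ℝ} {u₁ u₂ : ℝ → ℝ}
    (h₁ : ∀ x, |u₁ x| ≤ C * (1 + x ^ 2)⁻¹) (h₂ : ∀ x, |u₁ x - u₂ x| ≤ e * (1 + x ^ 2)⁻¹)
    {n₁ n₂ : ℝ → ℂ} {d N : ℝ} (hd : ∀ x, ‖n₁ x - n₂ x‖ ≤ d) (hN : ∀ x, ‖n₂ x‖ ≤ N) (y : ℝ) :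
    ‖weightedSource k C u₁ n₁ y - weightedSource k C u₂ n₂ y‖ ≤ ‖k‖ ^ 2 * (C * d + e * N) *
      (Real.exp (-(weightExp k C * Real.arctan y)) * (1 + y ^ 2)⁻¹) := by
  have hC : 0 ≤ C := by have := (abs_nonneg _).trans (h₁ 0); simpa using this
  have he : 0 ≤ e := by have := (abs_nonneg _).trans (h₂ 0); simpa using this
  have h : weightedSource k C u₁ n₁ y - weightedSource k C u₂ n₂ y =
      k ^ 2 * (Real.exp (-(weightExp k C * Real.arctan y)) : ℂ) *
        ((u₁ y : ℂ) * (n₁ y - n₂ y) + ((u₁ y - u₂ y : ℝ) : ℂ) * n₂ y) := by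
    unfold weightedSource; push_cast; ring
  have h' : ‖(u₁ y : ℂ) * (n₁ y - n₂ y) + ((u₁ y - u₂ y : ℝ) : ℂ) * n₂ y‖ ≤
      C * (1 + y ^ 2)⁻¹ * d + e * (1 + y ^ 2)⁻¹ * N := by
    refine (norm_add_le _ _).trans ?_
    rw [norm_mul, norm_mul, Complex.norm_real, Complex.norm_real]
    exact add_le_add (mul_le_mul (h₁ y) (hd y) (norm_nonneg _) (by positivity))
      (mul_le_mul (h₂ y) (hN y) (norm_nonneg _) (by positivity))
  rw [h, norm_mul, norm_mul, norm_pow, Complex.norm_real, Real.norm_of_nonneg (Real.exp_pos _).le]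
  calc _ ≤ ‖k‖ ^ 2 * Real.exp (-(weightExp k C * Real.arctan y)) *
        (C * (1 + y ^ 2)⁻¹ * d + e * (1 + y ^ 2)⁻¹ * N) := by gcongr
    _ = _ := by ring

theorem integrable_weightedSource (k : ℂ) {C : ℝ} {u : ℝ → ℝ} (hu : Continuous u)
    (h : ∀ x, |u x| ≤ C * (1 + x ^ 2)⁻¹) (n : BoundedContinuousFunction ℝ ℂ) :
    Integrable (weightedSource k C u n) := by
  have hC : 0 ≤ C := by have := (abs_nonneg _).trans (h 0); simpa using this
  refine ((integrable_exp_neg_mul_arctan (weightExp_pos k hC).le).const_mul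
    (‖k‖ ^ 2 * (C * ‖n‖ + 0 * 0))).mono'
    (continuous_weightedSource k C hu n.continuous).aestronglyMeasurable (ae_of_all _ fun y => ?_)
  have := norm_weightedSource_sub_le k (e := 0) h (u₂ := u) (by simp) (n₁ := n) (n₂ := 0)
    (d := ‖n‖) (N := 0) (fun x => by simpa using n.norm_coe_le_norm x) (by simp) y
  simpa [weightedSource] using this

/-- One estimate with three uses: equal potentials (e = 0) give the contraction, n₂ = 0 gives the
sup bound of the fixed point, and different potentials give the Lipschitz dependence. -/
theorem norm_weighted_volterra_sub_le {k : ℂ} (hk : 0 ≤ k.im) (hk0 : k ≠ 0) {C e : ℝ}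
    {u₁ u₂ : ℝ → ℝ} (hu₁ : Continuous u₁) (hu₂ : Continuous u₂)
    (h₁ : ∀ x, |u₁ x| ≤ C * (1 + x ^ 2)⁻¹) (h₂ : ∀ x, |u₂ x| ≤ C * (1 + x ^ 2)⁻¹)
    (h₁₂ : ∀ x, |u₁ x - u₂ x| ≤ e * (1 + x ^ 2)⁻¹)
    (n₁ n₂ : BoundedContinuousFunction ℝ ℂ) (x : ℝ) :
    ‖(Real.exp (weightExp k C * Real.arctan x) : ℂ) * volterra k (weightedSource k C u₁ n₁) x -
      (Real.exp (weightExp k C * Real.arctan x) : ℂ) * volterra k (weightedSource k C u₂ n₂) x‖ ≤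
      1 / 2 * ‖n₁ - n₂‖ + ‖k‖ * e * ‖n₂‖ := by
  have hC : 0 ≤ C := by have := (abs_nonneg _).trans (h₁ 0); simpa using this
  have he : 0 ≤ e := by have := (abs_nonneg _).trans (h₁₂ 0); simpa using this
  have hl := weightExp_pos k hC
  rw [← mul_sub, volterra_sub hk (continuous_weightedSource k C hu₁ n₁.continuous)
    (integrable_weightedSource k hu₁ h₁ n₁) (continuous_weightedSource k C hu₂ n₂.continuous)
    (integrable_weightedSource k hu₂ h₂ n₂)]
  refine (norm_exp_arctan_mul_volterra_le hk hl (by positivity)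
    (norm_weightedSource_sub_le k h₁ h₁₂ (fun x => (n₁ - n₂).norm_coe_le_norm x)
      n₂.norm_coe_le_norm) x).trans ?_
  have hk' : 0 < ‖k‖ := norm_pos_iff.2 hk0
  -- With l = 2‖k‖C + 1, the term 2‖k‖C makes ‖k‖C/l at most 1/2, and the 1 makes l ≥ 1, so that
  -- dividing the second summand by l does no harm.
  have e1 : ‖k‖⁻¹ * (‖k‖ ^ 2 * (C * ‖n₁ - n₂‖ + e * ‖n₂‖)) * (weightExp k C)⁻¹ =
      (‖k‖ * C * ‖n₁ - n₂‖ + ‖k‖ * e * ‖n₂‖) / weightExp k C := by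
    field_simp
  rw [e1, div_le_iff₀ hl, weightExp]
  have a1 : 0 ≤ ‖k‖ * C := by positivity
  have a2 : 0 ≤ ‖n₁ - n₂‖ := norm_nonneg _
  have a3 : 0 ≤ ‖k‖ * e * ‖n₂‖ := by positivity
  nlinarith [mul_nonneg a1 a2, mul_nonneg a1 a3]

theorem exists_weighted_fixedPoint {k : ℂ} (hk : 0 ≤ k.im) (hk0 : k ≠ 0) {C : ℝ}
    {u : ℝ → ℝ} (hu : Continuous u) (h : ∀ x, |u x| ≤ C * (1 + x ^ 2)⁻¹) :
    ∃ n : BoundedContinuousFunction ℝ ℂ, ∀ x, n x = Real.exp (weightExp k C * Real.arctan x) +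
      Real.exp (weightExp k C * Real.arctan x) * volterra k (weightedSource k C u n) x := by
  have hC : 0 ≤ C := by have := (abs_nonneg _).trans (h 0); simpa using this
  have hl := weightExp_pos k hC
  have key := norm_weighted_volterra_sub_le hk hk0 hu hu h h (e := 0) (by simp)
  have hcont : ∀ n : BoundedContinuousFunction ℝ ℂ,
      Continuous (volterra k (weightedSource k C u n)) := fun n =>
    continuous_iff_continuousAt.2 fun x => (hasDerivAt_volterra hk hk0
      (continuous_weightedSource k C hu n.continuous)
      (integrable_weightedSource k hu h n) x).continuousAt
  let T : BoundedContinuousFunction ℝ ℂ → BoundedContinuousFunction ℝ ℂ := fun n =>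
    BoundedContinuousFunction.ofNormedAddCommGroup
      (fun x => (Real.exp (weightExp k C * Real.arctan x) : ℂ) +
        Real.exp (weightExp k C * Real.arctan x) * volterra k (weightedSource k C u n) x)
      (by have := hcont n; fun_prop)
      (Real.exp (weightExp k C * (Real.pi / 2)) + 1 / 2 * ‖n‖) (fun x => by
        refine (norm_add_le _ _).trans (add_le_add ?_ ?_)
        · rw [Complex.norm_real, Real.norm_of_nonneg (Real.exp_pos _).le]
          exact exp_mul_arctan_le hl.le x
        · have := key n 0 x
          simpa [weightedSource, volterra] using this)
  have hT : ContractingWith (1 / 2) T := by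
    refine ⟨by rw [← NNReal.coe_lt_coe]; norm_num, LipschitzWith.of_dist_le_mul fun n₁ n₂ => ?_⟩
    refine (BoundedContinuousFunction.dist_le (by positivity)).2 fun x => ?_
    rw [dist_eq_norm, dist_eq_norm]
    have := key n₁ n₂ x
    simp only [T, BoundedContinuousFunction.coe_ofNormedAddCommGroup, add_sub_add_left_eq_sub]
    simpa using this
  refine ⟨ContractingWith.fixedPoint T hT, fun x => ?_⟩
  have := DFunLike.congr_fun (hT.fixedPoint_isFixedPt) x
  exact this.symm

theorem norm_weighted_fixedPoint_le {k : ℂ} (hk : 0 ≤ k.im) (hk0 : k ≠ 0) {C : ℝ}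
    {u : ℝ → ℝ} (hu : Continuous u) (h : ∀ x, |u x| ≤ C * (1 + x ^ 2)⁻¹)
    {n : BoundedContinuousFunction ℝ ℂ}
    (hn : ∀ x, n x = Real.exp (weightExp k C * Real.arctan x) +
      Real.exp (weightExp k C * Real.arctan x) * volterra k (weightedSource k C u n) x) :
    ‖n‖ ≤ 2 * Real.exp (weightExp k C * (Real.pi / 2)) := by
  have hC : 0 ≤ C := by have := (abs_nonneg _).trans (h 0); simpa using this
  have hl := weightExp_pos k hC
  have key := norm_weighted_volterra_sub_le hk hk0 hu hu h h (e := 0) (by simp) n 0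
  have : ‖n‖ ≤ Real.exp (weightExp k C * (Real.pi / 2)) + 1 / 2 * ‖n‖ := by
    refine (BoundedContinuousFunction.norm_le (by positivity)).2 fun x => ?_
    rw [hn x]
    refine (norm_add_le _ _).trans (add_le_add ?_ ?_)
    · rw [Complex.norm_real, Real.norm_of_nonneg (Real.exp_pos _).le]
      exact exp_mul_arctan_le hl.le x
    · simpa [weightedSource, volterra] using key x
  linarith

theorem norm_weighted_fixedPoint_sub_le {k : ℂ} (hk : 0 ≤ k.im) (hk0 : k ≠ 0) {C e : ℝ}
    {u₁ u₂ : ℝ → ℝ} (hu₁ : Continuous u₁) (hu₂ : Continuous u₂)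
    (h₁ : ∀ x, |u₁ x| ≤ C * (1 + x ^ 2)⁻¹) (h₂ : ∀ x, |u₂ x| ≤ C * (1 + x ^ 2)⁻¹)
    (h₁₂ : ∀ x, |u₁ x - u₂ x| ≤ e * (1 + x ^ 2)⁻¹)
    {n₁ n₂ : BoundedContinuousFunction ℝ ℂ}
    (hn₁ : ∀ x, n₁ x = Real.exp (weightExp k C * Real.arctan x) +
      Real.exp (weightExp k C * Real.arctan x) * volterra k (weightedSource k C u₁ n₁) x)
    (hn₂ : ∀ x, n₂ x = Real.exp (weightExp k C * Real.arctan x) +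
      Real.exp (weightExp k C * Real.arctan x) * volterra k (weightedSource k C u₂ n₂) x) :
    ‖n₁ - n₂‖ ≤ 4 * ‖k‖ * Real.exp (weightExp k C * (Real.pi / 2)) * e := by
  have he : 0 ≤ e := by have := (abs_nonneg _).trans (h₁₂ 0); simpa using this
  have key := norm_weighted_volterra_sub_le hk hk0 hu₁ hu₂ h₁ h₂ h₁₂ n₁ n₂
  have h3 : ‖n₁ - n₂‖ ≤ 1 / 2 * ‖n₁ - n₂‖ + ‖k‖ * e * ‖n₂‖ := by
    refine (BoundedContinuousFunction.norm_le (by positivity)).2 fun x => ?_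
    have := key x
    rwa [BoundedContinuousFunction.sub_apply, hn₁ x, hn₂ x, add_sub_add_left_eq_sub]
  have h4 := norm_weighted_fixedPoint_le hk hk0 hu₂ h₂ hn₂
  have h5 : ‖k‖ * e * ‖n₂‖ ≤ ‖k‖ * e * (2 * Real.exp (weightExp k C * (Real.pi / 2))) := by gcongr
  linarith

/-- The Volterra equation `m = 1 + volterra k (k² u m)` has a bounded solution, with a bound and
a Lipschitz dependence on `u` that are uniform in `u`. -/
theorem exists_volterra_solution {k : ℂ} (hk : 0 ≤ k.im) (hk0 : k ≠ 0) {C : ℝ} (hC : 0 ≤ C) :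
    ∃ N : ℝ, 0 ≤ N ∧ ∃ M : (ℝ → ℝ) → ℝ → ℂ,
      ∀ u : ℝ → ℝ, Continuous u → (∀ x, |u x| ≤ C * (1 + x ^ 2)⁻¹) →
        Continuous (M u) ∧ (∀ x, ‖M u x‖ ≤ N) ∧
        (∀ x, M u x = 1 + volterra k (fun y => k ^ 2 * u y * M u y) x) ∧
        ∀ u₂ : ℝ → ℝ, Continuous u₂ → (∀ x, |u₂ x| ≤ C * (1 + x ^ 2)⁻¹) →
          ∀ e : ℝ, (∀ x, |u x - u₂ x| ≤ e * (1 + x ^ 2)⁻¹) → ∀ x, ‖M u x - M u₂ x‖ ≤ N * e := by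
  have hl := weightExp_pos k hC
  have hex : ∀ u : ℝ → ℝ, ∃ n : BoundedContinuousFunction ℝ ℂ,
      Continuous u → (∀ x, |u x| ≤ C * (1 + x ^ 2)⁻¹) →
      ∀ x, n x = Real.exp (weightExp k C * Real.arctan x) +
      Real.exp (weightExp k C * Real.arctan x) * volterra k (weightedSource k C u n) x := by
    intro u
    by_cases h : Continuous u ∧ (∀ x, |u x| ≤ C * (1 + x ^ 2)⁻¹)
    · obtain ⟨n, hn⟩ := exists_weighted_fixedPoint hk hk0 h.1 h.2
      exact ⟨n, fun _ _ => hn⟩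
    -- A default value for inadmissible u: the solution becomes a total function of u, so that its
    -- values at two potentials can be compared.
    · exact ⟨0, fun h1 h2 => absurd ⟨h1, h2⟩ h⟩
  choose n hn using hex
  set P := Real.exp (weightExp k C * (Real.pi / 2)) with hP
  have hq : ∀ x, ‖(Real.exp (-(weightExp k C * Real.arctan x)) : ℂ)‖ ≤ P := fun x => by
    rw [Complex.norm_real, Real.norm_of_nonneg (Real.exp_pos _).le]
    exact exp_neg_mul_arctan_le hl.le x
  have hP0 : 0 < P := Real.exp_pos _
  -- The sup bound plus the Lipschitz constant. The extra factor P in each comes from removing the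
  -- weight.
  refine ⟨P * (2 * P) + P * (4 * ‖k‖ * P), by positivity,
    fun u x => (Real.exp (-(weightExp k C * Real.arctan x)) : ℂ) * n u x, fun u hu h => ?_⟩
  refine ⟨by fun_prop, fun x => ?_, fun x => ?_, fun u₂ hu₂ h₂ e he x => ?_⟩
  · rw [norm_mul]
    have h1 := ((n u).norm_coe_le_norm x).trans
      (norm_weighted_fixedPoint_le hk hk0 hu h (hn u hu h))
    calc _ ≤ P * (2 * P) := mul_le_mul (hq x) h1 (norm_nonneg _) hP0.le
      _ ≤ _ := by
        have : 0 ≤ P * (4 * ‖k‖ * P) := by positivity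
        linarith
  · have : (Real.exp (-(weightExp k C * Real.arctan x)) : ℂ) *
        (Real.exp (weightExp k C * Real.arctan x) : ℂ) = 1 := by
      rw [← Complex.ofReal_mul, ← Real.exp_add]; simp
    simp only
    rw [hn u hu h x]
    change _ = 1 + volterra k (weightedSource k C u (n u)) x
    linear_combination (1 + volterra k (weightedSource k C u (n u)) x) * this
  · have he0 : 0 ≤ e := by have := (abs_nonneg _).trans (he 0); simpa using this
    rw [← mul_sub, norm_mul]
    have h1 := ((n u - n u₂).norm_coe_le_norm x).trans
      (norm_weighted_fixedPoint_sub_le hk hk0 hu hu₂ h h₂ he (hn u hu h) (hn u₂ hu₂ h₂))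
    calc _ ≤ P * (4 * ‖k‖ * P * e) := mul_le_mul (hq x) h1 (norm_nonneg _) hP0.le
      _ ≤ _ := by
        have : 0 ≤ P * (2 * P) * e := by positivity
        linarith

/-! ### Jost solutions: existence, uniform bounds, dependence on the potential -/

/-- `ψ` is the Jost solution at `+∞`, normalised by `e^{-ikx} ψ → 1`, with explicit bounds. -/
structure IsJostRight (ρ : ℝ → ℝ) (k : ℂ) (B : ℝ) (ψ : ℝ → ℂ) : Prop where
  sol : IsSolution ρ k ψ
  tendsto : Tendsto (fun x : ℝ => Complex.exp (-(Complex.I * k * x)) * ψ x) atTop (𝓝 1)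
  tendsto_deriv : Tendsto (fun x : ℝ => Complex.exp (-(Complex.I * k * x)) * deriv ψ x) atTop
    (𝓝 (Complex.I * k))
  bound : ∀ x : ℝ, ‖Complex.exp (-(Complex.I * k * x)) * ψ x‖ ≤ B
  bound_deriv : ∀ x : ℝ, ‖Complex.exp (-(Complex.I * k * x)) * deriv ψ x‖ ≤ B

/-- `φ` is the Jost solution at `-∞`, normalised by `e^{ikx} φ → 1`, with explicit bounds. -/
structure IsJostLeft (ρ : ℝ → ℝ) (k : ℂ) (B : ℝ) (φ : ℝ → ℂ) : Prop where
  sol : IsSolution ρ k φ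
  tendsto : Tendsto (fun x : ℝ => Complex.exp (Complex.I * k * x) * φ x) atBot (𝓝 1)
  tendsto_deriv : Tendsto (fun x : ℝ => Complex.exp (Complex.I * k * x) * deriv φ x) atBot
    (𝓝 (-(Complex.I * k)))
  bound : ∀ x : ℝ, ‖Complex.exp (Complex.I * k * x) * φ x‖ ≤ B
  bound_deriv : ∀ x : ℝ, ‖Complex.exp (Complex.I * k * x) * deriv φ x‖ ≤ B

theorem hasDerivAt_exp_mul (c : ℂ) (x : ℝ) :
    HasDerivAt (fun x : ℝ => Complex.exp (c * x)) (Complex.exp (c * x) * c) x := by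
  simpa using ((hasDerivAt_id x).ofReal_comp.const_mul c).cexp

theorem exp_neg_mul_exp (z w : ℂ) : Complex.exp (-z) * (Complex.exp z * w) = w := by
  rw [← mul_assoc, ← Complex.exp_add]; simp

theorem integral_Ioi_inv_one_add_sq_le (x : ℝ) : ∫ y in Ioi x, (1 + y ^ 2)⁻¹ ≤ Real.pi := by
  rw [integral_Ioi_inv_one_add_sq]
  linarith [Real.neg_pi_div_two_lt_arctan x]

theorem tendsto_integral_Ioi_inv_one_add_sq :
    Tendsto (fun x : ℝ => ∫ y in Ioi x, (1 + y ^ 2)⁻¹) atTop (𝓝 0) := by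
  simp only [integral_Ioi_inv_one_add_sq]
  have := tendsto_nhds_of_tendsto_nhdsWithin Real.tendsto_arctan_atTop
  simpa using this.const_sub (Real.pi / 2)

/-- With ψ = e^{ikx} m the equation becomes m'' + 2ik m' = k²(1 - ρ²) m, which the Volterra equation
with u = 1 - ρ² solves with m → 1 at +∞. A single B serves all potentials with the same C, which
later gives a bound independent of time. -/
theorem exists_jostRight {k : ℂ} (hk : 0 ≤ k.im) (hk0 : k ≠ 0) {C : ℝ} (hC : 0 ≤ C) :
    ∃ B : ℝ, 0 ≤ B ∧ ∃ J : (ℝ → ℝ) → ℝ → ℂ,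
      ∀ ρ : ℝ → ℝ, Continuous ρ → (∀ x, |1 - ρ x ^ 2| ≤ C * (1 + x ^ 2)⁻¹) →
        IsJostRight ρ k B (J ρ) ∧
        ∀ ρ₂ : ℝ → ℝ, Continuous ρ₂ → (∀ x, |1 - ρ₂ x ^ 2| ≤ C * (1 + x ^ 2)⁻¹) →
          ∀ e : ℝ, (∀ x, |ρ x ^ 2 - ρ₂ x ^ 2| ≤ e * (1 + x ^ 2)⁻¹) →
            ∀ x : ℝ, ‖Complex.exp (-(Complex.I * k * x)) * (J ρ x - J ρ₂ x)‖ ≤ B * e := by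
  obtain ⟨N, hN, M, hM⟩ := exists_volterra_solution hk hk0 hC
  set D := ‖k‖ ^ 2 * C * N with hD
  refine ⟨N + (‖k‖ * N + D * Real.pi), by positivity,
    fun ρ x => Complex.exp (Complex.I * k * x) * M (fun y => 1 - ρ y ^ 2) x, fun ρ hρ h => ?_⟩
  obtain ⟨hc, hb, heq, hlip⟩ := hM (fun y => 1 - ρ y ^ 2) (by fun_prop) h
  set m := M (fun y => 1 - ρ y ^ 2) with hm
  set f : ℝ → ℂ := fun y => k ^ 2 * ((1 - ρ y ^ 2 : ℝ) : ℂ) * m y with hf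
  have hfc : Continuous f := by fun_prop
  have hfb : ∀ x, ‖f x‖ ≤ D * (1 + x ^ 2)⁻¹ := fun x => by
    rw [hf]; simp only
    rw [norm_mul, norm_mul, norm_pow, Complex.norm_real, Real.norm_eq_abs]
    calc _ ≤ ‖k‖ ^ 2 * (C * (1 + x ^ 2)⁻¹) * N := by gcongr; exacts [h x, hb x]
      _ = _ := by rw [hD]; ring
  have hfi : Integrable f := integrable_of_norm_le_inv_one_add_sq hfc hfb
  have hgi : ∀ x, IntegrableOn (fun y : ℝ => D * (1 + y ^ 2)⁻¹) (Ioi x) := fun x =>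
    (integrable_inv_one_add_sq.const_mul D).integrableOn
  have hm' : ∀ x, HasDerivAt m (-volterraDeriv k f x) x := fun x => by
    have := (hasDerivAt_volterra hk hk0 hfc hfi x).const_add 1
    rwa [← show m = _ from funext heq] at this
  have hd : ∀ x : ℝ, HasDerivAt (fun x : ℝ => Complex.exp (Complex.I * k * x) * m x)
      (Complex.exp (Complex.I * k * x) * (Complex.I * k * m x - volterraDeriv k f x)) x := fun x =>
    ((hasDerivAt_exp_mul (Complex.I * k) x).mul (hm' x)).congr_deriv (by ring)
  have hderiv : deriv (fun x : ℝ => Complex.exp (Complex.I * k * x) * m x) = fun x : ℝ =>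
      Complex.exp (Complex.I * k * x) * (Complex.I * k * m x - volterraDeriv k f x) :=
    funext fun x => (hd x).deriv
  have hvb : ∀ x, ‖volterraDeriv k f x‖ ≤ D * ∫ y in Ioi x, (1 + y ^ 2)⁻¹ := fun x => by
    rw [← integral_const_mul]; exact norm_volterraDeriv_le hk (hgi x) hfb
  have hvlim : Tendsto (volterraDeriv k f) atTop (𝓝 0) := by
    refine squeeze_zero_norm hvb ?_
    simpa using tendsto_integral_Ioi_inv_one_add_sq.const_mul D
  have hmlim : Tendsto m atTop (𝓝 1) := by
    rw [show m = _ from funext heq]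
    have : Tendsto (volterra k f) atTop (𝓝 0) := by
      refine squeeze_zero_norm (fun x => norm_volterra_le hk (hgi x) hfb) ?_
      simp only [integral_const_mul]
      simpa using (tendsto_integral_Ioi_inv_one_add_sq.const_mul D).const_mul ‖k‖⁻¹
    simpa using this.const_add 1
  have hpos : 0 ≤ ‖k‖ * N + D * Real.pi := by positivity
  change IsJostRight ρ k _ (fun x : ℝ => Complex.exp (Complex.I * k * x) * m x) ∧ _
  refine ⟨⟨⟨fun x => (hd x).differentiableAt, fun x => ?_⟩, ?_, ?_, fun x => ?_, fun x => ?_⟩,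
    fun ρ₂ hρ₂ h₂ e he x => ?_⟩
  · rw [hderiv]
    refine ((hasDerivAt_exp_mul (Complex.I * k) x).mul (((hm' x).const_mul (Complex.I * k)).sub
      (hasDerivAt_volterraDeriv hk hfc hfi x))).congr_deriv ?_
    simp only [hf, Pi.sub_apply]
    push_cast
    linear_combination k ^ 2 * Complex.exp (Complex.I * k * x) * m x * Complex.I_sq
  · simp only [exp_neg_mul_exp]; exact hmlim
  · simp only [hderiv, exp_neg_mul_exp]
    simpa using (hmlim.const_mul (Complex.I * k)).sub hvlim
  · simp only [exp_neg_mul_exp]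
    linarith [hb x]
  · simp only [hderiv, exp_neg_mul_exp]
    have h1 : ‖Complex.I * k * m x‖ ≤ ‖k‖ * N := by
      rw [norm_mul, norm_mul, Complex.norm_I, one_mul]; gcongr; exact hb x
    have h2 : ‖volterraDeriv k f x‖ ≤ D * Real.pi :=
      (hvb x).trans (by gcongr; exact integral_Ioi_inv_one_add_sq_le x)
    linarith [norm_sub_le (Complex.I * k * m x) (volterraDeriv k f x)]
  · have he0 : 0 ≤ e := by have := (abs_nonneg _).trans (he 0); simpa using this
    rw [mul_sub, exp_neg_mul_exp, exp_neg_mul_exp]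
    have := hlip (fun y => 1 - ρ₂ y ^ 2) (by fun_prop) h₂ e (fun x => by
      rw [abs_sub_comm]; simpa using he x) x
    have h3 : 0 ≤ (‖k‖ * N + D * Real.pi) * e := by positivity
    linarith

theorem deriv_comp_neg_eq (ψ : ℝ → ℂ) : deriv (fun x => ψ (-x)) = fun x => -deriv ψ (-x) :=
  funext fun x => deriv_comp_neg ψ x

theorem IsSolution.comp_neg {ρ : ℝ → ℝ} {k : ℂ} {ψ : ℝ → ℂ}
    (h : IsSolution (fun x => ρ (-x)) k ψ) : IsSolution ρ k (fun x => ψ (-x)) := by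
  refine ⟨h.1.comp differentiable_neg, fun x => ?_⟩
  rw [deriv_comp_neg_eq]
  exact ((h.2 (-x)).scomp x (hasDerivAt_neg x)).neg.congr_deriv (by simp)

/-- The reflection x ↦ -x preserves the form of the equation and exchanges the two ends, so the left
theory is read off from the right one. -/
theorem IsJostRight.comp_neg {ρ : ℝ → ℝ} {k : ℂ} {B : ℝ} {ψ : ℝ → ℂ}
    (h : IsJostRight (fun x => ρ (-x)) k B ψ) : IsJostLeft ρ k B (fun x => ψ (-x)) := by
  refine ⟨h.sol.comp_neg, ?_, ?_, fun x => ?_, fun x => ?_⟩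
  · simpa [Function.comp_def] using h.tendsto.comp tendsto_neg_atBot_atTop
  · rw [deriv_comp_neg_eq]
    simpa [Function.comp_def] using (h.tendsto_deriv.comp tendsto_neg_atBot_atTop).neg
  · simpa using h.bound (-x)
  · rw [deriv_comp_neg_eq]
    simpa using h.bound_deriv (-x)

theorem exists_jostLeft {k : ℂ} (hk : 0 ≤ k.im) (hk0 : k ≠ 0) {C : ℝ} (hC : 0 ≤ C) :
    ∃ B : ℝ, 0 ≤ B ∧ ∃ J : (ℝ → ℝ) → ℝ → ℂ,
      ∀ ρ : ℝ → ℝ, Continuous ρ → (∀ x, |1 - ρ x ^ 2| ≤ C * (1 + x ^ 2)⁻¹) →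
        IsJostLeft ρ k B (J ρ) ∧
        ∀ ρ₂ : ℝ → ℝ, Continuous ρ₂ → (∀ x, |1 - ρ₂ x ^ 2| ≤ C * (1 + x ^ 2)⁻¹) →
          ∀ e : ℝ, (∀ x, |ρ x ^ 2 - ρ₂ x ^ 2| ≤ e * (1 + x ^ 2)⁻¹) →
            ∀ x : ℝ, ‖Complex.exp (Complex.I * k * x) * (J ρ x - J ρ₂ x)‖ ≤ B * e := by
  obtain ⟨B, hB, J, hJ⟩ := exists_jostRight hk hk0 hC
  refine ⟨B, hB, fun ρ x => J (fun y => ρ (-y)) (-x), fun ρ hρ h => ?_⟩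
  obtain ⟨h1, h2⟩ := hJ (fun y => ρ (-y)) (by fun_prop) (fun x => by simpa using h (-x))
  refine ⟨h1.comp_neg, fun ρ₂ hρ₂ h₂ e he x => ?_⟩
  have := h2 (fun y => ρ₂ (-y)) (by fun_prop) (fun x => by simpa using h₂ (-x)) e
    (fun x => by simpa using he (-x)) (-x)
  simpa using this

/-! ### Wronskians and uniqueness of solutions with given asymptotics -/

/-- The Wronskian `f g' - f' g`. -/
def wronskian (f g : ℝ → ℂ) (x : ℝ) : ℂ := f x * deriv g x - deriv f x * g x

theorem IsSolution.hasDerivAt {ρ : ℝ → ℝ} {k : ℂ} {f : ℝ → ℂ} (h : IsSolution ρ k f) (x : ℝ) :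
    HasDerivAt f (deriv f x) x := (h.1 x).hasDerivAt

theorem IsSolution.continuous {ρ : ℝ → ℝ} {k : ℂ} {f : ℝ → ℂ} (h : IsSolution ρ k f) :
    Continuous f := h.1.continuous

/-- Used with κ = -k, to pair a left Jost solution at k with a right one at -k. -/
theorem IsSolution.of_sq_eq {ρ : ℝ → ℝ} {k κ : ℂ} {f : ℝ → ℂ} (h : IsSolution ρ κ f)
    (hκ : κ ^ 2 = k ^ 2) : IsSolution ρ k f := ⟨h.1, by rw [← hκ]; exact h.2⟩

theorem IsSolution.sub {ρ : ℝ → ℝ} {k : ℂ} {f g : ℝ → ℂ} (hf : IsSolution ρ k f)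
    (hg : IsSolution ρ k g) : IsSolution ρ k (fun x => f x - g x) := by
  have hd : deriv (fun x => f x - g x) = fun x => deriv f x - deriv g x :=
    funext fun x => ((hf.hasDerivAt x).sub (hg.hasDerivAt x)).deriv
  refine ⟨hf.1.sub hg.1, fun x => ?_⟩
  rw [hd]
  exact ((hf.2 x).sub (hg.2 x)).congr_deriv (by ring)

theorem IsSolution.const_mul {ρ : ℝ → ℝ} {k : ℂ} {f : ℝ → ℂ} (hf : IsSolution ρ k f) (c : ℂ) :
    IsSolution ρ k (fun x => c * f x) := by
  have hd : deriv (fun x => c * f x) = fun x => c * deriv f x :=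
    funext fun x => ((hf.hasDerivAt x).const_mul c).deriv
  refine ⟨hf.1.const_mul c, fun x => ?_⟩
  rw [hd]
  exact ((hf.2 x).const_mul c).congr_deriv (by ring)

theorem hasDerivAt_wronskian {ρ₁ ρ₂ : ℝ → ℝ} {k : ℂ} {f g : ℝ → ℂ} (hf : IsSolution ρ₁ k f)
    (hg : IsSolution ρ₂ k g) (x : ℝ) :
    HasDerivAt (wronskian f g) (k ^ 2 * (((ρ₁ x ^ 2 - ρ₂ x ^ 2 : ℝ) : ℂ) * (f x * g x))) x := by
  refine (((hf.hasDerivAt x).mul (hg.2 x)).sub ((hf.2 x).mul (hg.hasDerivAt x))).congr_deriv ?_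
  push_cast
  ring

theorem wronskian_eq {ρ : ℝ → ℝ} {k : ℂ} {f g : ℝ → ℂ} (hf : IsSolution ρ k f)
    (hg : IsSolution ρ k g) (x y : ℝ) : wronskian f g x = wronskian f g y := by
  refine is_const_of_deriv_eq_zero
    (fun x => (hasDerivAt_wronskian hf hg x).differentiableAt) (fun x => ?_) x y
  rw [(hasDerivAt_wronskian hf hg x).deriv]
  simp

theorem IsSolution.eq_zero {ρ : ℝ → ℝ} {k : ℂ} {d : ℝ → ℂ} (hd : IsSolution ρ k d) {K : ℝ}
    (hK : ∀ x, ρ x ^ 2 ≤ K) {x₀ : ℝ} (h0 : d x₀ = 0) (h1 : deriv d x₀ = 0) (x : ℝ) : d x = 0 := by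
  have hK0 : 0 ≤ K := (sq_nonneg _).trans (hK 0)
  let v : ℝ → ℂ × ℂ → ℂ × ℂ := fun t p => (p.2, -(k ^ 2 * (ρ t : ℂ) ^ 2 * p.1))
  -- A Lipschitz constant, uniform in x, of the first-order system for (d, d') in the maximum norm.
  let L : NNReal := ⟨max 1 (‖k‖ ^ 2 * K), by positivity⟩
  have hv : ∀ t, LipschitzOnWith L (v t) univ := fun t => by
    refine LipschitzOnWith.of_dist_le_mul fun p _ q _ => ?_
    rw [Prod.dist_eq, Prod.dist_eq]
    simp only [v, dist_eq_norm]
    change _ ≤ max 1 (‖k‖ ^ 2 * K) * _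
    refine max_le ?_ ?_
    · calc _ ≤ 1 * max ‖p.1 - q.1‖ ‖p.2 - q.2‖ := by rw [one_mul]; exact le_max_right _ _
        _ ≤ _ := by gcongr; exact le_max_left _ _
    · have : -(k ^ 2 * (ρ t : ℂ) ^ 2 * p.1) - -(k ^ 2 * (ρ t : ℂ) ^ 2 * q.1) =
        -(k ^ 2 * ((ρ t ^ 2 : ℝ) : ℂ) * (p.1 - q.1)) := by push_cast; ring
      rw [this, norm_neg, norm_mul, norm_mul, norm_pow, Complex.norm_real,
        Real.norm_of_nonneg (sq_nonneg _)]
      calc _ ≤ (‖k‖ ^ 2 * K) * max ‖p.1 - q.1‖ ‖p.2 - q.2‖ := by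
            gcongr
            · exact hK t
            · exact le_max_left _ _
        _ ≤ _ := by gcongr; exact le_max_right _ _
  have := ODE_solution_unique_univ (v := v) (s := fun _ => univ) (K := L) (t₀ := x₀)
    (f := fun t => (d t, deriv d t)) (g := fun _ => 0) hv
    (fun t => ⟨(hd.hasDerivAt t).prodMk (hd.2 t), mem_univ _⟩)
    (fun t => ⟨(hasDerivAt_const t _).congr_deriv (by simp [v, Prod.ext_iff]), mem_univ _⟩) (by simp [h0, h1])
  exact congr_arg Prod.fst (congr_fun this x)

/-- The increment G(x + 1) - G(x) tends to 0, and by the mean value inequality also to c. -/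
theorem eq_zero_of_tendsto_of_tendsto_deriv {G G' : ℝ → ℂ} {c : ℂ}
    (hG : ∀ᶠ x in atTop, HasDerivAt G (G' x) x) (h0 : Tendsto G atTop (𝓝 0))
    (hc : Tendsto G' atTop (𝓝 c)) : c = 0 := by
  have key : ∀ e > 0, ‖c‖ ≤ e := fun e he => by
    obtain ⟨R, hR⟩ := eventually_atTop.1
      (hG.and ((tendsto_iff_norm_sub_tendsto_zero.1 hc).eventually (gt_mem_nhds he)))
    have h1 : ∀ x ≥ R, ‖(G (x + 1) - G x) - c‖ ≤ e := fun x hx => by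
      have := (convex_Ici R).norm_image_sub_le_of_norm_hasDerivWithin_le (C := e)
        (f := fun y : ℝ => G y - y * c) (f' := fun y => G' y - 1 * c)
        (fun y hy => ((hR y hy).1.sub
          ((hasDerivAt_id y).ofReal_comp.mul_const c)).hasDerivWithinAt)
        (fun y hy => by rw [one_mul]; exact (hR y hy).2.le) (x := x) (y := x + 1) hx
        (mem_Ici.2 (by linarith))
      have e1 : (G (x + 1) - ((x + 1 : ℝ) : ℂ) * c) - (G x - (x : ℂ) * c) =
        (G (x + 1) - G x) - c := by push_cast; ring
      rw [e1] at this
      simpa using this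
    have h2 : Tendsto (fun x => ‖(G (x + 1) - G x) - c‖) atTop (𝓝 ‖(0 - 0) - c‖) :=
      ((h0.comp (tendsto_atTop_add_const_right _ 1 tendsto_id)).sub h0 |>.sub_const c).norm
    have := le_of_tendsto h2 (eventually_atTop.2 ⟨R, h1⟩)
    simpa using this
  exact norm_le_zero_iff.1 (le_of_forall_pos_le_add fun e he => by simpa using key e he)

theorem IsJostRight.eventually_ne_zero {ρ : ℝ → ℝ} {k : ℂ} {B : ℝ} {ψ : ℝ → ℂ}
    (h : IsJostRight ρ k B ψ) : ∀ᶠ x in atTop, ψ x ≠ 0 := by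
  filter_upwards [h.tendsto.eventually_ne one_ne_zero] with x hx h0
  exact hx (by rw [h0, mul_zero])

/-- A solution that is small compared with the Jost solution at `+∞` vanishes. -/
theorem IsJostRight.eq_zero_of_tendsto {ρ : ℝ → ℝ} {k : ℂ} {B : ℝ} {ψ d : ℝ → ℂ}
    (hψ : IsJostRight ρ k B ψ) (hk : 0 ≤ k.im) {K : ℝ} (hK : ∀ x, ρ x ^ 2 ≤ K)
    (hd : IsSolution ρ k d)
    (h0 : Tendsto (fun x : ℝ => Complex.exp (-(Complex.I * k * x)) * d x) atTop (𝓝 0)) (x : ℝ) :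
    d x = 0 := by
  set W := wronskian d ψ 0 with hW
  have hWx : ∀ x, d x * deriv ψ x - deriv d x * ψ x = W := fun x => wronskian_eq hd hψ.sol x 0
  have hquot : Tendsto (fun x => d x / ψ x) atTop (𝓝 0) := by
    have := h0.div hψ.tendsto one_ne_zero
    rw [zero_div] at this
    refine this.congr fun x => ?_
    rw [Pi.div_apply, mul_div_mul_left _ _ (Complex.exp_ne_zero _)]
  have hF : ∀ x, ψ x ≠ 0 → HasDerivAt (fun x => d x / ψ x) (-W / ψ x ^ 2) x := fun x hx => by
    refine ((hd.hasDerivAt x).div (hψ.sol.hasDerivAt x) hx).congr_deriv ?_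
    rw [← hWx x]; ring
  -- The function G = e^{2ikx} d/ψ tends to 0, and its derivative tends to -W because e^{2ikx}/ψ² →
  -- 1. This treats Im k = 0 and Im k > 0 at once. After that d/ψ is constant near +∞, with limit 0.
  have hW0 : W = 0 := by
    have hG0 : Tendsto (fun x : ℝ => Complex.exp (2 * Complex.I * k * x) * (d x / ψ x)) atTop
        (𝓝 0) := by
      refine squeeze_zero_norm' (a := fun x => ‖d x / ψ x‖) ?_ (by simpa using hquot.norm)
      filter_upwards [eventually_ge_atTop 0] with x hx
      rw [norm_mul]
      exact mul_le_of_le_one_left (norm_nonneg _) (norm_exp_two_I_mul_le_one hk hx)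
    have hlim : Tendsto (fun x : ℝ => Complex.exp (2 * Complex.I * k * x) * (2 * Complex.I * k) *
        (d x / ψ x) + Complex.exp (2 * Complex.I * k * x) * (-W / ψ x ^ 2)) atTop (𝓝 (-W)) := by
      have h1 := (hG0.const_mul (2 * Complex.I * k)).add
        ((tendsto_const_nhds (x := -W)).div (hψ.tendsto.pow 2) (by simp))
      simp only [mul_zero, zero_add, one_pow, div_one] at h1
      refine h1.congr fun x => ?_
      have e1 : Complex.exp (2 * Complex.I * k * x) *
          Complex.exp (-(Complex.I * k * x)) ^ 2 = 1 := by
        rw [← Complex.exp_nat_mul, ← Complex.exp_add]; push_cast; ring_nf; simp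
      have e2 : -W / (Complex.exp (-(Complex.I * k * x)) * ψ x) ^ 2 =
          Complex.exp (2 * Complex.I * k * x) * (-W / ψ x ^ 2) := by
        rw [mul_pow, eq_comm, ← mul_div_mul_left _ _
          (pow_ne_zero 2 (Complex.exp_ne_zero (-(Complex.I * k * x)))), ← mul_div_assoc]
        congr 1
        linear_combination -W * e1
      simp only [Pi.div_apply]
      rw [e2]; ring
    have := eq_zero_of_tendsto_of_tendsto_deriv (hψ.eventually_ne_zero.mono fun x hx =>
      (hasDerivAt_exp_mul (2 * Complex.I * k) x).mul (hF x hx)) hG0 hlim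
    simpa using this
  obtain ⟨R, hR⟩ := eventually_atTop.1 hψ.eventually_ne_zero
  have hconst : ∀ x ≥ R, d x = 0 := fun x hx => by
    have h1 : ∀ y ≥ R, d y / ψ y = d x / ψ x := fun y hy => by
      have := (convex_Ici R).norm_image_sub_le_of_norm_hasDerivWithin_le (C := 0)
        (f := fun x => d x / ψ x) (f' := fun y => -W / ψ y ^ 2)
        (fun y hy => (hF y (hR y hy)).hasDerivWithinAt) (fun y _ => by simp [hW0]) (x := x) hx hy
      simpa [sub_eq_zero] using this
    have h2 : d x / ψ x = 0 := tendsto_nhds_unique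
      (tendsto_const_nhds.congr' (eventually_atTop.2 ⟨R, fun y hy => (h1 y hy).symm⟩)) hquot
    exact (div_eq_zero_iff.1 h2).resolve_right (hR x hx)
  refine hd.eq_zero hK (hconst (R + 1) (by linarith)) ?_ x
  have : d =ᶠ[𝓝 (R + 1)] fun _ => 0 := by
    filter_upwards [Ioi_mem_nhds (show R < R + 1 by linarith)] with y hy
    exact hconst y (le_of_lt hy)
  rw [this.deriv_eq, deriv_const]

/-! ### Evolution of the Wronskian of a left and a right Jost solution -/

theorem norm_exp_I_mul_of_im_eq {k κ : ℂ} (h : κ.im = k.im) (x : ℝ) :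
    ‖Complex.exp (Complex.I * κ * x)‖ = ‖Complex.exp (Complex.I * k * x)‖ := by
  simp [Complex.norm_exp, h]

theorem norm_exp_neg_I_mul_of_im_eq {k κ : ℂ} (h : κ.im = k.im) (x : ℝ) :
    ‖Complex.exp (-(Complex.I * κ * x))‖ = ‖Complex.exp (-(Complex.I * k * x))‖ := by
  simp [Complex.norm_exp, h]

theorem IsJostLeft.bound' {ρ : ℝ → ℝ} {k κ : ℂ} {B : ℝ} {φ : ℝ → ℂ} (h : IsJostLeft ρ k B φ)
    (hκ : κ.im = k.im) (x : ℝ) : ‖Complex.exp (Complex.I * κ * x) * φ x‖ ≤ B := by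
  rw [norm_mul, norm_exp_I_mul_of_im_eq hκ, ← norm_mul]; exact h.bound x

theorem IsJostLeft.bound_deriv' {ρ : ℝ → ℝ} {k κ : ℂ} {B : ℝ} {φ : ℝ → ℂ}
    (h : IsJostLeft ρ k B φ) (hκ : κ.im = k.im) (x : ℝ) :
    ‖Complex.exp (Complex.I * κ * x) * deriv φ x‖ ≤ B := by
  rw [norm_mul, norm_exp_I_mul_of_im_eq hκ, ← norm_mul]; exact h.bound_deriv x

theorem IsJostRight.bound' {ρ : ℝ → ℝ} {k κ : ℂ} {B : ℝ} {ψ : ℝ → ℂ} (h : IsJostRight ρ κ B ψ)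
    (hκ : κ.im = k.im) (x : ℝ) : ‖Complex.exp (-(Complex.I * k * x)) * ψ x‖ ≤ B := by
  rw [norm_mul, ← norm_exp_neg_I_mul_of_im_eq hκ, ← norm_mul]; exact h.bound x

theorem IsJostRight.bound_deriv' {ρ : ℝ → ℝ} {k κ : ℂ} {B : ℝ} {ψ : ℝ → ℂ}
    (h : IsJostRight ρ κ B ψ) (hκ : κ.im = k.im) (x : ℝ) :
    ‖Complex.exp (-(Complex.I * k * x)) * deriv ψ x‖ ≤ B := by
  rw [norm_mul, ← norm_exp_neg_I_mul_of_im_eq hκ, ← norm_mul]; exact h.bound_deriv x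

theorem tendsto_mul_zero_of_bound {a b : ℝ → ℂ} {B : ℝ} {l : Filter ℝ} (ha : ∀ x, ‖a x‖ ≤ B)
    (hb : Tendsto b l (𝓝 0)) : Tendsto (fun x => a x * b x) l (𝓝 0) := by
  refine squeeze_zero_norm (a := fun x => B * ‖b x‖) (fun x => ?_) (by simpa using hb.norm.const_mul B)
  rw [norm_mul]
  exact mul_le_mul_of_nonneg_right (ha x) (norm_nonneg _)

/-- The weights cancel in the product. Products of a left and a right Jost solution are thus bounded
on the whole line, although for Im k > 0 the bounds allow either factor to grow at one end. -/
theorem norm_mul_le_of_weighted {k a b : ℂ} {B x : ℝ} (ha : ‖Complex.exp (Complex.I * k * x) * a‖ ≤ B)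
    (hb : ‖Complex.exp (-(Complex.I * k * x)) * b‖ ≤ B) : ‖a * b‖ ≤ B * B := by
  have : a * b = (Complex.exp (Complex.I * k * x) * a) *
      (Complex.exp (-(Complex.I * k * x)) * b) := by
    rw [mul_mul_mul_comm, ← Complex.exp_add]; simp
  rw [this, norm_mul]
  exact mul_le_mul ha hb (norm_nonneg _) ((norm_nonneg _).trans ha)

theorem tendsto_mul_zero_of_weighted_right {k : ℂ} {a b : ℝ → ℂ} {B : ℝ} {l : Filter ℝ}
    (ha : ∀ x : ℝ, ‖Complex.exp (Complex.I * k * x) * a x‖ ≤ B)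
    (hb : Tendsto (fun x : ℝ => Complex.exp (-(Complex.I * k * x)) * b x) l (𝓝 0)) :
    Tendsto (fun x => a x * b x) l (𝓝 0) := by
  refine (tendsto_mul_zero_of_bound ha hb).congr fun x => ?_
  rw [mul_mul_mul_comm, ← Complex.exp_add]; simp

theorem tendsto_mul_zero_of_weighted_left {k : ℂ} {a b : ℝ → ℂ} {B : ℝ} {l : Filter ℝ}
    (ha : ∀ x : ℝ, ‖Complex.exp (-(Complex.I * k * x)) * a x‖ ≤ B)
    (hb : Tendsto (fun x : ℝ => Complex.exp (Complex.I * k * x) * b x) l (𝓝 0)) :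
    Tendsto (fun x => a x * b x) l (𝓝 0) := by
  refine (tendsto_mul_zero_of_bound ha hb).congr fun x => ?_
  rw [mul_mul_mul_comm, ← Complex.exp_add]; simp

section Wronskian

variable {ρ₁ ρ₂ : ℝ → ℝ} {k κ : ℂ} {B : ℝ} {φ₁ φ₂ ψ₁ ψ₂ : ℝ → ℂ}

/-- ψ₁ and ψ₂ have the same asymptotics at +∞ and the weighted φ₁ is bounded there, so replacing ψ₂
by ψ₁ costs o(1), and W(φ₁, ψ₁) is constant. -/
theorem tendsto_wronskian_atTop (hsq : κ ^ 2 = k ^ 2) (him : κ.im = k.im)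
    (hφ : IsJostLeft ρ₁ k B φ₁) (hψ₁ : IsJostRight ρ₁ κ B ψ₁) (hψ₂ : IsJostRight ρ₂ κ B ψ₂) :
    Tendsto (wronskian φ₁ ψ₂) atTop (𝓝 (wronskian φ₁ ψ₁ 0)) := by
  have h1 := tendsto_mul_zero_of_weighted_right (l := atTop)
    (b := fun x => deriv ψ₂ x - deriv ψ₁ x) (hφ.bound' him)
    (by simpa [mul_sub] using hψ₂.tendsto_deriv.sub hψ₁.tendsto_deriv)
  have h2 := tendsto_mul_zero_of_weighted_right (l := atTop)
    (b := fun x => ψ₂ x - ψ₁ x) (hφ.bound_deriv' him)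
    (by simpa [mul_sub] using hψ₂.tendsto.sub hψ₁.tendsto)
  have h3 := (h1.sub h2).const_add (wronskian φ₁ ψ₁ 0)
  rw [sub_zero, add_zero] at h3
  refine h3.congr fun x => ?_
  rw [wronskian_eq hφ.sol (hψ₁.sol.of_sq_eq hsq) 0 x, wronskian, wronskian]
  ring

theorem tendsto_wronskian_atBot (hsq : κ ^ 2 = k ^ 2) (him : κ.im = k.im)
    (hφ₁ : IsJostLeft ρ₁ k B φ₁) (hφ₂ : IsJostLeft ρ₂ k B φ₂) (hψ : IsJostRight ρ₂ κ B ψ₂) :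
    Tendsto (wronskian φ₁ ψ₂) atBot (𝓝 (wronskian φ₂ ψ₂ 0)) := by
  have h1 := tendsto_mul_zero_of_weighted_left (l := atBot)
    (b := fun x => φ₁ x - φ₂ x) (hψ.bound_deriv' him)
    (by simpa [mul_sub] using hφ₁.tendsto.sub hφ₂.tendsto)
  have h2 := tendsto_mul_zero_of_weighted_left (l := atBot)
    (b := fun x => deriv φ₁ x - deriv φ₂ x) (hψ.bound' him)
    (by simpa [mul_sub] using hφ₁.tendsto_deriv.sub hφ₂.tendsto_deriv)
  have h3 := (h1.sub h2).const_add (wronskian φ₂ ψ₂ 0)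
  rw [sub_zero, add_zero] at h3
  refine h3.congr fun x => ?_
  rw [wronskian_eq hφ₂.sol (hψ.sol.of_sq_eq hsq) 0 x, wronskian, wronskian]
  ring

theorem wronskian_sub_eq_integral (hsq : κ ^ 2 = k ^ 2) (him : κ.im = k.im)
    (hφ₁ : IsJostLeft ρ₁ k B φ₁) (hφ₂ : IsJostLeft ρ₂ k B φ₂)
    (hψ₁ : IsJostRight ρ₁ κ B ψ₁) (hψ₂ : IsJostRight ρ₂ κ B ψ₂)
    (hρ₁ : Continuous ρ₁) (hρ₂ : Continuous ρ₂) {e : ℝ}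
    (he : ∀ x, |ρ₁ x ^ 2 - ρ₂ x ^ 2| ≤ e * (1 + x ^ 2)⁻¹) :
    wronskian φ₁ ψ₁ 0 - wronskian φ₂ ψ₂ 0 =
      ∫ x, k ^ 2 * (((ρ₁ x ^ 2 - ρ₂ x ^ 2 : ℝ) : ℂ) * (φ₁ x * ψ₂ x)) := by
  refine (integral_of_hasDerivAt_of_tendsto
    (hasDerivAt_wronskian hφ₁.sol (hψ₂.sol.of_sq_eq hsq)) ?_
    (tendsto_wronskian_atBot hsq him hφ₁ hφ₂ hψ₂)
    (tendsto_wronskian_atTop hsq him hφ₁ hψ₁ hψ₂)).symm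
  refine integrable_of_norm_le_inv_one_add_sq (D := ‖k‖ ^ 2 * (e * (B * B))) ?_ fun x => ?_
  · have := hφ₁.sol.continuous
    have := hψ₂.sol.continuous
    fun_prop
  · have h1 := norm_mul_le_of_weighted (hφ₁.bound x) (hψ₂.bound' him x)
    rw [norm_mul, norm_mul, norm_pow, Complex.norm_real, Real.norm_eq_abs]
    calc _ ≤ ‖k‖ ^ 2 * ((e * (1 + x ^ 2)⁻¹) * (B * B)) := by
          gcongr
          exacts [(abs_nonneg _).trans (he x), he x]
      _ = _ := by ring

end Wronskian

/-- The error made in the antiderivative `Φ` of `integral_deriv_three_mul` when ρ and 1/ρ are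
replaced by 1, and the derivatives of 1/ρ by 0. -/
theorem tendsto_jost_products_zero {l : Filter ℝ} {r A A₁ A₂ ρ : ℝ → ℝ}
    (lr : Tendsto r l (𝓝 1)) (lA : Tendsto A l (𝓝 1))
    (l1 : Tendsto A₁ l (𝓝 0)) (l2 : Tendsto A₂ l (𝓝 0))
    {k κ : ℂ} (him : κ.im = k.im) {B : ℝ} {φ ψ : ℝ → ℂ}
    (hφ : IsJostLeft ρ k B φ) (hψ : IsJostRight ρ κ B ψ) :
    Tendsto (fun x => (φ x * ψ x) * (A₂ x : ℂ) - (deriv φ x * ψ x) * (A₁ x : ℂ) -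
      (φ x * deriv ψ x) * (A₁ x : ℂ) + 2 * k ^ 2 * ((φ x * ψ x) * ((r x - 1 : ℝ) : ℂ)) +
      2 * ((deriv φ x * deriv ψ x) * ((A x - 1 : ℝ) : ℂ))) l (𝓝 0) := by
  have c : ∀ {f : ℝ → ℝ}, Tendsto f l (𝓝 0) → Tendsto (fun x => (f x : ℂ)) l (𝓝 0) := fun hf => by
    rw [← Complex.ofReal_zero]
    exact (Complex.continuous_ofReal.tendsto 0).comp hf
  have c1 : ∀ {f : ℝ → ℝ}, Tendsto f l (𝓝 1) →
      Tendsto (fun x => ((f x - 1 : ℝ) : ℂ)) l (𝓝 0) := fun {f} hf => by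
    have h := hf.sub_const 1
    rw [sub_self] at h
    exact c (f := fun x => f x - 1) h
  have t1 := tendsto_mul_zero_of_bound
    (fun x => norm_mul_le_of_weighted (hφ.bound x) (hψ.bound' him x)) (c l2)
  have t2 := tendsto_mul_zero_of_bound
    (fun x => norm_mul_le_of_weighted (hφ.bound_deriv x) (hψ.bound' him x)) (c l1)
  have t3 := tendsto_mul_zero_of_bound
    (fun x => norm_mul_le_of_weighted (hφ.bound x) (hψ.bound_deriv' him x)) (c l1)
  have t4 := (tendsto_mul_zero_of_bound
    (fun x => norm_mul_le_of_weighted (hφ.bound x) (hψ.bound' him x)) (c1 lr)).const_mul (2 * k ^ 2)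
  have t5 := (tendsto_mul_zero_of_bound (fun x => norm_mul_le_of_weighted (hφ.bound_deriv x)
    (hψ.bound_deriv' him x)) (c1 lA)).const_mul 2
  rw [mul_zero] at t4 t5
  have := (((t1.sub t2).sub t3).add t4).add t5
  simp only [sub_zero, add_zero] at this
  exact this

/-- The third derivative of `1/ρ` integrates to a multiple of the Wronskian against products of
Jost solutions. -/
theorem integral_deriv_three_mul {ρ A A₁ A₂ A₃ : ℝ → ℝ} (hρ : ∀ x, ρ x ≠ 0)
    (hA : ∀ x, A x = 1 / ρ x)
    (h0 : ∀ x, HasDerivAt A (A₁ x) x) (h1 : ∀ x, HasDerivAt A₁ (A₂ x) x)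
    (h2 : ∀ x, HasDerivAt A₂ (A₃ x) x) (hc3 : Continuous A₃)
    {D : ℝ} (h3 : ∀ x, |A₃ x| ≤ D * (1 + x ^ 2)⁻¹)
    (lρ : Tendsto ρ (cocompact ℝ) (𝓝 1))
    (l1 : Tendsto A₁ (cocompact ℝ) (𝓝 0)) (l2 : Tendsto A₂ (cocompact ℝ) (𝓝 0))
    {k κ : ℂ} (hsq : κ ^ 2 = k ^ 2) (him : κ.im = k.im) {B : ℝ} {φ ψ : ℝ → ℂ}
    (hφ : IsJostLeft ρ k B φ) (hψ : IsJostRight ρ κ B ψ) :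
    ∫ x, (A₃ x : ℂ) * (φ x * ψ x) = 2 * Complex.I * (k - κ) * wronskian φ ψ 0 := by
  have hψs : IsSolution ρ k ψ := hψ.sol.of_sq_eq hsq
  set W := wronskian φ ψ 0 with hW
  have hWx : ∀ x, φ x * deriv ψ x - deriv φ x * ψ x = W := fun x => wronskian_eq hφ.sol hψs x 0
  have hρ' : ∀ x, HasDerivAt ρ (-A₁ x / A x ^ 2) x := fun x => by
    have h := (h0 x).inv (by rw [hA]; exact one_div_ne_zero (hρ x))
    have e : ρ = A⁻¹ := funext fun y => by simp [hA]
    rwa [← e] at h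
  have lA : Tendsto A (cocompact ℝ) (𝓝 1) := by
    rw [show A = fun x => 1 / ρ x from funext hA]
    simpa using lρ.inv₀ one_ne_zero
  -- With p = φψ and p'' = -2k²ρ²p + 2φ'ψ', this is A''p - A'p' + Ap'' + 4k²ρp.
  let Φ : ℝ → ℂ := fun x => (A₂ x : ℂ) * (φ x * ψ x) -
    (A₁ x : ℂ) * (deriv φ x * ψ x + φ x * deriv ψ x) + 2 * k ^ 2 * ((ρ x : ℂ) * (φ x * ψ x)) +
    2 * ((A x : ℂ) * (deriv φ x * deriv ψ x))
  have hΦ : ∀ x, HasDerivAt Φ ((A₃ x : ℂ) * (φ x * ψ x)) x := fun x => by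
    have d1 := hφ.sol.hasDerivAt x
    have d2 := hφ.sol.2 x
    have d3 := hψs.hasDerivAt x
    have d4 := hψs.2 x
    refine (((((h2 x).ofReal_comp).mul (d1.mul d3)).sub (((h1 x).ofReal_comp).mul
      ((d2.mul d3).add (d1.mul d4)))).add
      ((((hρ' x).ofReal_comp).mul (d1.mul d3)).const_mul (2 * k ^ 2)) |>.add
      ((((h0 x).ofReal_comp).mul (d2.mul d4)).const_mul 2)).congr_deriv ?_
    have hr : (ρ x : ℂ) ≠ 0 := by exact_mod_cast hρ x
    simp only [Pi.mul_apply, Pi.add_apply, hA]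
    push_cast
    field_simp
    ring
  have hint : Integrable fun x => (A₃ x : ℂ) * (φ x * ψ x) := by
    refine integrable_of_norm_le_inv_one_add_sq (D := D * (B * B)) ?_ fun x => ?_
    · have := hφ.sol.continuous
      have := hψs.continuous
      fun_prop
    · have h1 := norm_mul_le_of_weighted (hφ.bound x) (hψ.bound' him x)
      rw [norm_mul, Complex.norm_real, Real.norm_eq_abs]
      calc _ ≤ (D * (1 + x ^ 2)⁻¹) * (B * B) := by
            gcongr
            exacts [(abs_nonneg _).trans (h3 x), h3 x]
        _ = _ := by ring
  have hrest := tendsto_jost_products_zero lρ lA l1 l2 him hφ hψ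
  have htop : Tendsto Φ atTop (𝓝 (-(2 * Complex.I * κ * W))) := by
    -- The leading part satisfies 2k²φψ + 2φ'ψ' + 2iκW = φ(2k²ψ + 2iκψ') + φ'(2ψ' - 2iκψ), and both
    -- brackets vanish after weighting because ψ' ~ iκψ. The other end is the same with φ' ~ -ikφ.
    have t1 := tendsto_mul_zero_of_weighted_right (l := atTop)
      (b := fun x => 2 * k ^ 2 * ψ x + 2 * Complex.I * κ * deriv ψ x) (hφ.bound' him) (by
        have := (hψ.tendsto.const_mul (2 * k ^ 2)).add
          (hψ.tendsto_deriv.const_mul (2 * Complex.I * κ))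
        convert this using 2
        · ring
        · linear_combination -2 * κ ^ 2 * Complex.I_sq + 2 * hsq)
    have t2 := tendsto_mul_zero_of_weighted_right (l := atTop)
      (b := fun x => 2 * deriv ψ x - 2 * Complex.I * κ * ψ x) (hφ.bound_deriv' him) (by
        have := (hψ.tendsto_deriv.const_mul 2).sub
          (hψ.tendsto.const_mul (2 * Complex.I * κ))
        convert this using 2
        · ring
        · ring)
    have := (((hrest.mono_left atTop_le_cocompact).add t1).add t2).add_const
      (-(2 * Complex.I * κ * W))
    rw [add_zero, add_zero, zero_add] at this
    refine this.congr fun x => ?_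
    simp only [Φ]
    push_cast
    linear_combination (2 * Complex.I * κ) * hWx x
  have hbot : Tendsto Φ atBot (𝓝 (-(2 * Complex.I * k * W))) := by
    have t1 := tendsto_mul_zero_of_weighted_left (l := atBot)
      (b := fun x => 2 * k ^ 2 * φ x - 2 * Complex.I * k * deriv φ x) (hψ.bound' him) (by
        have := (hφ.tendsto.const_mul (2 * k ^ 2)).sub
          (hφ.tendsto_deriv.const_mul (2 * Complex.I * k))
        convert this using 2
        · ring
        · linear_combination -2 * k ^ 2 * Complex.I_sq)
    have t2 := tendsto_mul_zero_of_weighted_left (l := atBot)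
      (b := fun x => 2 * deriv φ x + 2 * Complex.I * k * φ x) (hψ.bound_deriv' him) (by
        have := (hφ.tendsto_deriv.const_mul 2).add
          (hφ.tendsto.const_mul (2 * Complex.I * k))
        convert this using 2
        · ring
        · ring)
    have := (((hrest.mono_left atBot_le_cocompact).add t1).add t2).add_const
      (-(2 * Complex.I * k * W))
    rw [add_zero, add_zero, zero_add] at this
    refine this.congr fun x => ?_
    simp only [Φ]
    push_cast
    linear_combination (2 * Complex.I * k) * hWx x
  rw [integral_of_hasDerivAt_of_tendsto hΦ hint hbot htop]
  ring

/-- The evolution of the Wronskian of the Jost solutions. -/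
theorem hasDerivWithinAt_wronskian {I : Set ℝ} {s : ℝ} (hs : s ∈ I) {ρ : ℝ → ℝ → ℝ} {C : ℝ}
    (hc : ∀ t ∈ I, Continuous (ρ t))
    (hlip : ∀ t ∈ I, ∀ x, |ρ t x ^ 2 - ρ s x ^ 2| ≤ C * |t - s| * (1 + x ^ 2)⁻¹)
    {A A₁ A₂ A₃ : ℝ → ℝ} (hρ : ∀ x, ρ s x ≠ 0)
    (hA : ∀ x, A x = 1 / ρ s x)
    (h0 : ∀ x, HasDerivAt A (A₁ x) x) (h1 : ∀ x, HasDerivAt A₁ (A₂ x) x)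
    (h2 : ∀ x, HasDerivAt A₂ (A₃ x) x) (hc3 : Continuous A₃)
    {D : ℝ} (h3 : ∀ x, |A₃ x| ≤ D * (1 + x ^ 2)⁻¹)
    (lρ : Tendsto (ρ s) (cocompact ℝ) (𝓝 1))
    (l1 : Tendsto A₁ (cocompact ℝ) (𝓝 0)) (l2 : Tendsto A₂ (cocompact ℝ) (𝓝 0))
    (hd : ∀ x, HasDerivWithinAt (fun t => ρ t x ^ 2) (1 / 2 * A₃ x) I s)
    {k κ : ℂ} (hsq : κ ^ 2 = k ^ 2) (him : κ.im = k.im) {B : ℝ} {φ ψ : ℝ → ℝ → ℂ}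
    (hφ : ∀ t ∈ I, IsJostLeft (ρ t) k B (φ t)) (hψ : ∀ t ∈ I, IsJostRight (ρ t) κ B (ψ t))
    (hφlip : ∀ t ∈ I, ∀ x : ℝ,
      ‖Complex.exp (Complex.I * k * x) * (φ t x - φ s x)‖ ≤ B * (C * |t - s|)) :
    HasDerivWithinAt (fun t => wronskian (φ t) (ψ t) 0)
      (Complex.I * k ^ 2 * (k - κ) * wronskian (φ s) (ψ s) 0) I s := by
  have hval : Complex.I * k ^ 2 * (k - κ) * wronskian (φ s) (ψ s) 0 =
      ∫ x, k ^ 2 * (((1 / 2 * A₃ x : ℝ) : ℂ) * (φ s x * ψ s x)) := by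
    have := integral_deriv_three_mul hρ hA h0 h1 h2 hc3 h3 lρ l1 l2 hsq him (hφ s hs) (hψ s hs)
    have e : (fun x => k ^ 2 * (((1 / 2 * A₃ x : ℝ) : ℂ) * (φ s x * ψ s x))) =
        fun x => (k ^ 2 / 2) * ((A₃ x : ℂ) * (φ s x * ψ s x)) := by
      funext x; push_cast; ring
    rw [e, integral_const_mul, this]
    ring
  rw [hasDerivWithinAt_iff_tendsto_slope, hval]
  have hmem : ∀ᶠ t in 𝓝[I \ {s}] s, t ∈ I \ {s} := self_mem_nhdsWithin
  -- In the mixed Wronskian only φ moves with t while ψ stays at time s, so continuity in time is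
  -- needed for φ alone.
  have hslope : ∀ t ∈ I, slope (fun t => wronskian (φ t) (ψ t) 0) s t =
      ∫ x, k ^ 2 * ((slope (fun t => ρ t x ^ 2) s t : ℂ) * (φ t x * ψ s x)) := fun t ht => by
    rw [slope_def_module, wronskian_sub_eq_integral hsq him (hφ t ht) (hφ s hs) (hψ t ht)
      (hψ s hs) (hc t ht) (hc s hs) (hlip t ht), ← integral_smul]
    congr 1 with x
    rw [slope_def_module, Complex.real_smul, smul_eq_mul]
    push_cast
    ring
  refine Tendsto.congr' (hmem.mono fun t ht => (hslope t ht.1).symm) ?_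
  refine tendsto_integral_filter_of_dominated_convergence
    (fun x => ‖k‖ ^ 2 * (C * (1 + x ^ 2)⁻¹ * (B * B))) ?_ ?_ ?_ ?_
  · refine hmem.mono fun t ht => Continuous.aestronglyMeasurable ?_
    have := hc t ht.1
    have := hc s hs
    have := (hφ t ht.1).sol.continuous
    have := (hψ s hs).sol.continuous
    simp only [slope_def_module, smul_eq_mul]
    fun_prop
  · refine hmem.mono fun t ht => ae_of_all _ fun x => ?_
    have b := norm_mul_le_of_weighted ((hφ t ht.1).bound x) ((hψ s hs).bound' him x)
    have hts : 0 < |t - s| := abs_pos.2 (sub_ne_zero.2 ht.2)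
    have hs' : |slope (fun t => ρ t x ^ 2) s t| ≤ C * (1 + x ^ 2)⁻¹ := by
      rw [slope_def_module, smul_eq_mul, abs_mul, abs_inv, inv_mul_le_iff₀ hts]
      exact (hlip t ht.1 x).trans_eq (by ring)
    rw [norm_mul, norm_mul, norm_pow, Complex.norm_real, Real.norm_eq_abs]
    gcongr
    exact (abs_nonneg _).trans hs'
  · exact ((integrable_inv_one_add_sq.const_mul C).mul_const _).const_mul _
  · refine ae_of_all _ fun x => ?_
    have hl1 : Tendsto (fun t => (slope (fun t => ρ t x ^ 2) s t : ℂ)) (𝓝[I \ {s}] s)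
        (𝓝 ((1 / 2 * A₃ x : ℝ) : ℂ)) :=
      (Complex.continuous_ofReal.tendsto _).comp (hasDerivWithinAt_iff_tendsto_slope.1 (hd x))
    have hl2 : Tendsto (fun t => φ t x) (𝓝[I \ {s}] s) (𝓝 (φ s x)) := by
      have z : Tendsto (fun t => Complex.exp (Complex.I * k * x) * (φ t x - φ s x))
          (𝓝[I \ {s}] s) (𝓝 0) := by
        refine squeeze_zero_norm' (hmem.mono fun t ht => hφlip t ht.1 x) ?_
        have : Tendsto (fun t => B * (C * |t - s|)) (𝓝 s) (𝓝 (B * (C * |s - s|))) :=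
          Continuous.tendsto (by fun_prop) s
        simp only [sub_self, abs_zero, mul_zero] at this
        exact this.mono_left nhdsWithin_le_nhds
      have := (z.const_mul (Complex.exp (-(Complex.I * k * x)))).add_const (φ s x)
      simpa only [exp_neg_mul_exp, sub_add_cancel, mul_zero, zero_add] using this
    exact (hl1.mul (hl2.mul_const _)).const_mul _

/-! ### Weighted bounds for Schwartz functions -/

/-- A continuous seminorm that controls `(1 + x²) |f x|`. -/
def decayNorm (f : SchwartzMap ℝ ℝ) : ℝ :=
  SchwartzMap.seminorm ℝ 0 0 f + SchwartzMap.seminorm ℝ 2 0 f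

theorem continuous_decayNorm : Continuous decayNorm :=
  ((schwartz_withSeminorms ℝ ℝ ℝ).continuous_seminorm (0, 0)).add
    ((schwartz_withSeminorms ℝ ℝ ℝ).continuous_seminorm (2, 0))

theorem abs_le_decayNorm (f : SchwartzMap ℝ ℝ) (x : ℝ) :
    |f x| ≤ decayNorm f * (1 + x ^ 2)⁻¹ := by
  have h0 := SchwartzMap.norm_pow_mul_le_seminorm ℝ f 0 x
  have h2 := SchwartzMap.norm_pow_mul_le_seminorm ℝ f 2 x
  rw [← div_eq_mul_inv, le_div_iff₀ (by positivity), decayNorm]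
  simp only [Real.norm_eq_abs, sq_abs, pow_zero, one_mul] at h0 h2
  linarith

theorem inv_one_add_sq_le_one (x : ℝ) : (1 + x ^ 2)⁻¹ ≤ 1 :=
  inv_le_one_of_one_le₀ (by nlinarith [sq_nonneg x])

theorem tendsto_inv_one_add_sq : Tendsto (fun x : ℝ => (1 + x ^ 2)⁻¹) (cocompact ℝ) (𝓝 0) := by
  refine tendsto_inv_atTop_zero.comp (tendsto_atTop_add_const_left _ 1 ?_)
  have := (tendsto_pow_atTop (α := ℝ) two_ne_zero).comp (tendsto_norm_cocompact_atTop (E := ℝ))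
  simpa [Function.comp_def] using this

theorem tendsto_zero_of_abs_le_inv {f : ℝ → ℝ} {D : ℝ} (h : ∀ x, |f x| ≤ D * (1 + x ^ 2)⁻¹) :
    Tendsto f (cocompact ℝ) (𝓝 0) :=
  squeeze_zero_norm h (by simpa only [mul_zero] using tendsto_inv_one_add_sq.const_mul D)

theorem exists_pos_lower_bound {ρ : ℝ → ℝ} (hc : Continuous ρ) (hpos : ∀ x, 0 < ρ x)
    (h : Tendsto ρ (cocompact ℝ) (𝓝 1)) : ∃ c > 0, ∀ x, c ≤ ρ x := by
  -- Capping ρ at 1/2 makes the function equal to its upper bound far out, so a minimum is attained.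
  obtain ⟨x, hx⟩ := Continuous.exists_forall_le' (f := fun x => min (ρ x) (1 / 2)) (by fun_prop) 0
    ((h.eventually (eventually_gt_nhds (show (1 / 2 : ℝ) < 1 by norm_num))).mono fun x hx => by
      rw [min_eq_right hx.le]; exact min_le_right _ _)
  exact ⟨_, lt_min (hpos x) (by norm_num), fun y => (hx y).trans (min_le_left _ _)⟩

/-- The derivatives up to order three of `1 / (1 + f)`. -/
theorem exists_derivs_inv {f : SchwartzMap ℝ ℝ} {ρ : ℝ → ℝ} (hf : ∀ x, f x = ρ x - 1)
    {c C : ℝ} (hc : 0 < c) (hρ : ∀ x, c ≤ ρ x)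
    (h₁ : decayNorm (SchwartzMap.derivCLM ℝ ℝ f) ≤ C)
    (h₂ : decayNorm (SchwartzMap.derivCLM ℝ ℝ (SchwartzMap.derivCLM ℝ ℝ f)) ≤ C)
    (h₃ : decayNorm (SchwartzMap.derivCLM ℝ ℝ (SchwartzMap.derivCLM ℝ ℝ
      (SchwartzMap.derivCLM ℝ ℝ f))) ≤ C) :
    ∃ A₁ A₂ A₃ : ℝ → ℝ, (∀ x, HasDerivAt (fun x => 1 / ρ x) (A₁ x) x) ∧
      (∀ x, HasDerivAt A₁ (A₂ x) x) ∧ (∀ x, HasDerivAt A₂ (A₃ x) x) ∧ Continuous A₃ ∧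
      (∀ x, |A₃ x| ≤ (C / c ^ 2 + 6 * (C * C) / c ^ 3 + 6 * (C * C * C) / c ^ 4) *
        (1 + x ^ 2)⁻¹) ∧
      Tendsto A₁ (cocompact ℝ) (𝓝 0) ∧ Tendsto A₂ (cocompact ℝ) (𝓝 0) := by
  set f₁ := SchwartzMap.derivCLM ℝ ℝ f with hf₁
  set f₂ := SchwartzMap.derivCLM ℝ ℝ f₁ with hf₂
  set f₃ := SchwartzMap.derivCLM ℝ ℝ f₂ with hf₃
  have dS : ∀ (g : SchwartzMap ℝ ℝ) x, HasDerivAt g (SchwartzMap.derivCLM ℝ ℝ g x) x :=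
    fun g x => (g.differentiable x).hasDerivAt
  have hρf : ρ = fun x => f x + 1 := funext fun x => by rw [hf]; ring
  have d0 : ∀ x, HasDerivAt ρ (f₁ x) x := fun x => by
    rw [hρf]; exact (dS f x).add_const 1
  have hρc : Continuous ρ := continuous_iff_continuousAt.2 fun x => (d0 x).continuousAt
  have hpos : ∀ x, 0 < ρ x := fun x => hc.trans_le (hρ x)
  have hne : ∀ x, ρ x ≠ 0 := fun x => (hpos x).ne'
  have hi : ∀ x, |(ρ x)⁻¹| ≤ c⁻¹ := fun x => by
    rw [abs_of_pos (inv_pos.2 (hpos x))]; exact inv_anti₀ hc (hρ x)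
  have di : ∀ x, HasDerivAt (fun x => (ρ x)⁻¹) (-f₁ x * (ρ x)⁻¹ ^ 2) x := fun x =>
    ((d0 x).inv (hne x)).congr_deriv (by rw [div_eq_mul_inv, inv_pow])
  have b₁ : ∀ x, |f₁ x| ≤ C * (1 + x ^ 2)⁻¹ := fun x =>
    (abs_le_decayNorm f₁ x).trans (by gcongr)
  have b₂ : ∀ x, |f₂ x| ≤ C * (1 + x ^ 2)⁻¹ := fun x =>
    (abs_le_decayNorm f₂ x).trans (by gcongr)
  have b₃ : ∀ x, |f₃ x| ≤ C * (1 + x ^ 2)⁻¹ := fun x =>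
    (abs_le_decayNorm f₃ x).trans (by gcongr)
  have hC : 0 ≤ C := by have := (abs_nonneg _).trans (b₁ 0); simpa using this
  have b₁' : ∀ x, |f₁ x| ≤ C := fun x =>
    (b₁ x).trans (mul_le_of_le_one_right hC (inv_one_add_sq_le_one x))
  have t₁ := tendsto_zero_of_abs_le_inv b₁
  have t₂ := tendsto_zero_of_abs_le_inv b₂
  have tρ : Tendsto ρ (cocompact ℝ) (𝓝 1) := by
    rw [hρf]
    simpa only [zero_add] using (tendsto_zero_of_abs_le_inv (abs_le_decayNorm f)).add_const 1
  refine ⟨fun x => -f₁ x * (ρ x)⁻¹ ^ 2, fun x => -f₂ x * (ρ x)⁻¹ ^ 2 + 2 * f₁ x ^ 2 * (ρ x)⁻¹ ^ 3,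
    fun x => -f₃ x * (ρ x)⁻¹ ^ 2 + 6 * (f₁ x * f₂ x) * (ρ x)⁻¹ ^ 3 -
      6 * (f₁ x * f₁ x * f₁ x) * (ρ x)⁻¹ ^ 4,
    fun x => ?_, fun x => ?_, fun x => ?_, ?_, fun x => ?_, ?_, ?_⟩
  · simpa only [one_div] using di x
  · refine ((dS f₁ x).neg.mul ((di x).pow 2)).congr_deriv ?_
    simp only [Pi.neg_apply, Pi.pow_apply, ← hf₂]
    ring
  · refine (((dS f₂ x).neg.mul ((di x).pow 2)).add
      ((((dS f₁ x).pow 2).const_mul 2).mul ((di x).pow 3))).congr_deriv ?_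
    simp only [Pi.neg_apply, Pi.pow_apply, ← hf₂, ← hf₃]
    ring
  · have := f₁.continuous
    have := f₂.continuous
    have := f₃.continuous
    have := hρc.inv₀ hne
    fun_prop
  · have e1 : |-f₃ x * (ρ x)⁻¹ ^ 2| ≤ (C * (1 + x ^ 2)⁻¹) * c⁻¹ ^ 2 := by
      rw [abs_mul, abs_neg, abs_pow]
      gcongr
      exacts [b₃ x, hi x]
    have e2 : |6 * (f₁ x * f₂ x) * (ρ x)⁻¹ ^ 3| ≤ 6 * (C * (C * (1 + x ^ 2)⁻¹)) * c⁻¹ ^ 3 := by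
      rw [abs_mul, abs_mul, abs_mul, abs_pow, abs_of_pos (show (0 : ℝ) < 6 by norm_num)]
      gcongr
      exacts [b₁' x, b₂ x, hi x]
    have e3 : |6 * (f₁ x * f₁ x * f₁ x) * (ρ x)⁻¹ ^ 4| ≤
        6 * (C * C * (C * (1 + x ^ 2)⁻¹)) * c⁻¹ ^ 4 := by
      rw [abs_mul, abs_mul, abs_mul, abs_mul, abs_pow, abs_of_pos (show (0 : ℝ) < 6 by norm_num)]
      gcongr
      exacts [b₁' x, b₁' x, b₁ x, hi x]
    refine (abs_sub _ _).trans ((add_le_add ((abs_add_le _ _).trans (add_le_add e1 e2)) e3).trans_eq ?_)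
    field_simp
  · simpa using t₁.neg.mul ((tρ.inv₀ one_ne_zero).pow 2)
  · simpa using (t₂.neg.mul ((tρ.inv₀ one_ne_zero).pow 2)).add
      (((t₁.pow 2).const_mul 2).mul ((tρ.inv₀ one_ne_zero).pow 3))

theorem iteratedDeriv_three_eq {A A₁ A₂ A₃ : ℝ → ℝ} (h0 : ∀ x, HasDerivAt A (A₁ x) x)
    (h1 : ∀ x, HasDerivAt A₁ (A₂ x) x) (h2 : ∀ x, HasDerivAt A₂ (A₃ x) x) :
    iteratedDeriv 3 A = A₃ := by
  rw [iteratedDeriv_succ, iteratedDeriv_succ, iteratedDeriv_one,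
    show deriv A = A₁ from funext fun x => (h0 x).deriv,
    show deriv A₁ = A₂ from funext fun x => (h1 x).deriv,
    show deriv A₂ = A₃ from funext fun x => (h2 x).deriv]

/-! ### The Harry Dym flow near a given time -/

theorem IsHarryDymFlow.continuous {I : Set ℝ} {ρ : ℝ → ℝ → ℝ} (h : IsHarryDymFlow I ρ) {t : ℝ}
    (ht : t ∈ I) : Continuous (ρ t) := by
  obtain ⟨v, -, hv⟩ := h.schwartz
  have : ρ t = fun x => v t x + 1 := funext fun x => by rw [hv t ht]; ring
  rw [this]
  exact (v t).continuous.add continuous_const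

theorem IsHarryDymFlow.tendsto {I : Set ℝ} {ρ : ℝ → ℝ → ℝ} (h : IsHarryDymFlow I ρ) {t : ℝ}
    (ht : t ∈ I) : Tendsto (ρ t) (cocompact ℝ) (𝓝 1) := by
  obtain ⟨v, -, hv⟩ := h.schwartz
  have : ρ t = fun x => v t x + 1 := funext fun x => by rw [hv t ht]; ring
  rw [this]
  simpa only [zero_add] using (tendsto_zero_of_abs_le_inv (abs_le_decayNorm (v t))).add_const 1

theorem IsHarryDymFlow.exists_abs_sub_one_le {I : Set ℝ} {ρ : ℝ → ℝ → ℝ}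
    (h : IsHarryDymFlow I ρ) {t : ℝ} (ht : t ∈ I) :
    ∃ C, ∀ x, |ρ t x - 1| ≤ C * (1 + x ^ 2)⁻¹ := by
  obtain ⟨v, -, hv⟩ := h.schwartz
  exact ⟨_, fun x => by rw [← hv t ht]; exact abs_le_decayNorm (v t) x⟩

theorem IsHarryDymFlow.exists_derivs_inv {I : Set ℝ} {ρ : ℝ → ℝ → ℝ} (h : IsHarryDymFlow I ρ)
    {t : ℝ} (ht : t ∈ I) :
    ∃ (A₁ A₂ A₃ : ℝ → ℝ) (D : ℝ), (∀ x, HasDerivAt (fun x => 1 / ρ t x) (A₁ x) x) ∧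
      (∀ x, HasDerivAt A₁ (A₂ x) x) ∧ (∀ x, HasDerivAt A₂ (A₃ x) x) ∧ Continuous A₃ ∧
      (∀ x, |A₃ x| ≤ D * (1 + x ^ 2)⁻¹) ∧
      Tendsto A₁ (cocompact ℝ) (𝓝 0) ∧ Tendsto A₂ (cocompact ℝ) (𝓝 0) ∧
      ∀ x, HasDerivWithinAt (fun t => ρ t x ^ 2) (1 / 2 * A₃ x) I t := by
  obtain ⟨v, -, hv⟩ := h.schwartz
  obtain ⟨c, hc, hρ⟩ := exists_pos_lower_bound (h.continuous ht) (h.pos t ht) (h.tendsto ht)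
  obtain ⟨A₁, A₂, A₃, h0, h1, h2, h3, h4, h5, h6⟩ := Acoustic.exists_derivs_inv (hv t ht) hc hρ
    ((le_max_left _ _).trans (le_max_left _ _)) ((le_max_right _ _).trans (le_max_left _ _))
    (le_max_right _ _)
  refine ⟨A₁, A₂, A₃, _, h0, h1, h2, h3, h4, h5, h6, fun x => ?_⟩
  have := h.equation t ht x
  rwa [iteratedDeriv_three_eq h0 h1 h2] at this

/-- Locally uniform bounds for the flow. -/
theorem IsHarryDymFlow.exists_local_bounds {I : Set ℝ} (hI : I.OrdConnected) {ρ : ℝ → ℝ → ℝ}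
    (h : IsHarryDymFlow I ρ) {s : ℝ} (hs : s ∈ I) :
    ∃ U ∈ 𝓝 s, ∃ C c : ℝ, 0 ≤ C ∧ 0 < c ∧ ∀ t ∈ I ∩ U,
      (∀ x, |1 - ρ t x ^ 2| ≤ C * (1 + x ^ 2)⁻¹) ∧ (∀ x, c ≤ ρ t x) ∧
      ∀ x, |ρ t x ^ 2 - ρ s x ^ 2| ≤ C * |t - s| * (1 + x ^ 2)⁻¹ := by
  obtain ⟨v, hvc, hv⟩ := h.schwartz
  obtain ⟨c, hc, hρ⟩ := exists_pos_lower_bound (h.continuous hs) (h.pos s hs) (h.tendsto hs)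
  have ev : ∀ g : SchwartzMap ℝ ℝ → ℝ, Continuous g →
      ∀ᶠ t in 𝓝[I] s, g (v t) < g (v s) + 1 := fun g hg =>
    ((hg.tendsto _).comp (hvc s hs)).eventually (gt_mem_nhds (lt_add_one _))
  have hD := (SchwartzMap.derivCLM ℝ ℝ : SchwartzMap ℝ ℝ →L[ℝ] SchwartzMap ℝ ℝ).continuous
  have e0 := ev decayNorm continuous_decayNorm
  have e1 := ev (fun f => decayNorm (SchwartzMap.derivCLM ℝ ℝ f)) (continuous_decayNorm.comp hD)
  have e2 := ev (fun f => decayNorm (SchwartzMap.derivCLM ℝ ℝ (SchwartzMap.derivCLM ℝ ℝ f)))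
    (continuous_decayNorm.comp (hD.comp hD))
  have e3 := ev (fun f => decayNorm (SchwartzMap.derivCLM ℝ ℝ (SchwartzMap.derivCLM ℝ ℝ
    (SchwartzMap.derivCLM ℝ ℝ f)))) (continuous_decayNorm.comp (hD.comp (hD.comp hD)))
  have e4 : ∀ᶠ t in 𝓝[I] s, decayNorm (v t - v s) < c / 2 := by
    have hg : Continuous fun f => decayNorm (f - v s) :=
      continuous_decayNorm.comp (continuous_id.sub continuous_const)
    have : Tendsto (fun t => decayNorm (v t - v s)) (𝓝[I] s) (𝓝 (decayNorm (v s - v s))) :=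
      (hg.tendsto _).comp (hvc s hs)
    refine this.eventually (gt_mem_nhds ?_)
    simp [decayNorm, hc]
  have hall := ((e0.and e1).and (e2.and e3)).and e4
  obtain ⟨δ, hδ, hball⟩ := Metric.mem_nhdsWithin_iff.1 hall
  set C₁ := max (max (decayNorm (SchwartzMap.derivCLM ℝ ℝ (v s)) + 1)
    (decayNorm (SchwartzMap.derivCLM ℝ ℝ (SchwartzMap.derivCLM ℝ ℝ (v s))) + 1))
    (decayNorm (SchwartzMap.derivCLM ℝ ℝ (SchwartzMap.derivCLM ℝ ℝ
      (SchwartzMap.derivCLM ℝ ℝ (v s)))) + 1) with hC₁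
  set C₀ := decayNorm (v s) + 1 with hC₀
  set E := C₁ / (c / 2) ^ 2 + 6 * (C₁ * C₁) / (c / 2) ^ 3 +
    6 * (C₁ * C₁ * C₁) / (c / 2) ^ 4 with hE
  have hlow : ∀ t ∈ I ∩ Metric.ball s δ, ∀ x, c / 2 ≤ ρ t x := fun t ht x => by
    have h4 := (hball ⟨ht.2, ht.1⟩).2
    have h5 := (abs_le_decayNorm (v t - v s) x).trans (mul_le_of_le_one_right
      (by simp only [decayNorm]; positivity) (inv_one_add_sq_le_one x))
    rw [sub_apply, hv t ht.1, hv s hs] at h5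
    have h6 := (abs_le.1 (h5.trans h4.le)).1
    linarith [hρ x]
  -- Near s the Schwartz seminorms and the lower bound of ρ are controlled, so the same E bounds the
  -- right-hand side of the flow for all these times.
  have hderiv : ∀ t ∈ I ∩ Metric.ball s δ, ∀ x, ∃ a : ℝ,
      HasDerivWithinAt (fun t => ρ t x ^ 2) (1 / 2 * a) I t ∧ |a| ≤ E * (1 + x ^ 2)⁻¹ :=
    fun t ht x => by
    have hb := hball ⟨ht.2, ht.1⟩
    obtain ⟨A₁, A₂, A₃, h0, h1, h2, -, h4, -, -⟩ := Acoustic.exists_derivs_inv (C := C₁)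
      (hv t ht.1) (half_pos hc) (hlow t ht)
      (hb.1.1.2.le.trans ((le_max_left _ _).trans (le_max_left _ _)))
      (hb.1.2.1.le.trans ((le_max_right _ _).trans (le_max_left _ _)))
      (hb.1.2.2.le.trans (le_max_right _ _))
    have := h.equation t ht.1 x
    rw [iteratedDeriv_three_eq h0 h1 h2] at this
    exact ⟨_, this, h4 x⟩
  have hC₀0 : 0 ≤ C₀ := by rw [hC₀]; simp only [decayNorm]; positivity
  have hC₁0 : 0 ≤ C₁ := le_max_of_le_right (by simp only [decayNorm]; positivity)
  have hE0 : 0 ≤ E := by positivity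
  refine ⟨Metric.ball s δ, Metric.ball_mem_nhds s hδ, C₀ * (2 + C₀) + E, c / 2, by positivity,
    half_pos hc, fun t ht => ⟨fun x => ?_, hlow t ht, fun x => ?_⟩⟩
  · have h0 : |v t x| ≤ C₀ * (1 + x ^ 2)⁻¹ :=
      (abs_le_decayNorm (v t) x).trans (by gcongr; exact (hball ⟨ht.2, ht.1⟩).1.1.1.le)
    have h1 : |2 + v t x| ≤ 2 + C₀ := by
      refine (abs_add_le _ _).trans ?_
      rw [abs_of_pos (zero_lt_two)]
      gcongr
      exact h0.trans (mul_le_of_le_one_right hC₀0 (inv_one_add_sq_le_one x))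
    have e : 1 - ρ t x ^ 2 = -(v t x * (2 + v t x)) := by rw [hv t ht.1]; ring
    rw [e, abs_neg, abs_mul]
    calc _ ≤ C₀ * (1 + x ^ 2)⁻¹ * (2 + C₀) := by gcongr
      _ = C₀ * (2 + C₀) * (1 + x ^ 2)⁻¹ := by ring
      _ ≤ _ := by gcongr; linarith
  -- The pointwise equation becomes a Lipschitz bound by the mean value inequality in time at fixed
  -- x; here it matters that I is an interval.
  · have hconv : Convex ℝ (I ∩ Metric.ball s δ) := hI.convex.inter (convex_ball s δ)
    choose! a ha using fun t ht => hderiv t ht x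
    have := hconv.norm_image_sub_le_of_norm_hasDerivWithin_le (C := E * (1 + x ^ 2)⁻¹)
      (f := fun t => ρ t x ^ 2) (f' := fun t => 1 / 2 * a t)
      (fun t ht => (ha t ht).1.mono inter_subset_left) (fun t ht => by
        rw [Real.norm_eq_abs, abs_mul, abs_of_pos (show (0 : ℝ) < 1 / 2 by norm_num)]
        linarith [(ha t ht).2, abs_nonneg (a t)]) ⟨hs, Metric.mem_ball_self hδ⟩ ht
    rw [Real.norm_eq_abs, Real.norm_eq_abs] at this
    calc _ ≤ E * (1 + x ^ 2)⁻¹ * |t - s| := this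
      _ = E * |t - s| * (1 + x ^ 2)⁻¹ := by ring
      _ ≤ _ := by
        gcongr
        have : 0 ≤ C₀ * (2 + C₀) := by positivity
        linarith

/-! ### Conservation of `∫ (ρ - 1)` and the travel time -/

theorem IsHarryDymFlow.integrable {I : Set ℝ} {ρ : ℝ → ℝ → ℝ} (h : IsHarryDymFlow I ρ) {t : ℝ}
    (ht : t ∈ I) : Integrable fun x => ρ t x - 1 := by
  obtain ⟨C, hC⟩ := h.exists_abs_sub_one_le ht
  exact integrable_of_norm_le_inv_one_add_sq ((h.continuous ht).sub continuous_const) hC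

/-- A A''' is the derivative of A A'' - ½ A'², which vanishes at both ends. -/
theorem integral_mul_deriv_three_eq_zero {A A₁ A₂ A₃ : ℝ → ℝ}
    (h0 : ∀ x, HasDerivAt A (A₁ x) x) (h1 : ∀ x, HasDerivAt A₁ (A₂ x) x)
    (h2 : ∀ x, HasDerivAt A₂ (A₃ x) x) (hi : Integrable fun x => A x * A₃ x)
    (l0 : Tendsto A (cocompact ℝ) (𝓝 1)) (l1 : Tendsto A₁ (cocompact ℝ) (𝓝 0))
    (l2 : Tendsto A₂ (cocompact ℝ) (𝓝 0)) : ∫ x, A x * A₃ x = 0 := by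
  have hl : Tendsto (fun x => A x * A₂ x - 1 / 2 * A₁ x ^ 2) (cocompact ℝ) (𝓝 0) := by
    have := (l0.mul l2).sub ((l1.pow 2).const_mul (1 / 2))
    rwa [show (1 : ℝ) * 0 - 1 / 2 * 0 ^ 2 = 0 by norm_num] at this
  have := integral_of_hasDerivAt_of_tendsto (f := fun x => A x * A₂ x - 1 / 2 * A₁ x ^ 2)
    (fun x => (((h0 x).mul (h2 x)).sub (((h1 x).pow 2).const_mul (1 / 2))).congr_deriv
      (show _ = A x * A₃ x by norm_num; ring)) hi (hl.mono_left atBot_le_cocompact)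
    (hl.mono_left atTop_le_cocompact)
  rw [this, sub_zero]

theorem IsHarryDymFlow.hasDerivWithinAt_integral {I : Set ℝ} (hI : I.OrdConnected)
    {ρ : ℝ → ℝ → ℝ} (h : IsHarryDymFlow I ρ) {s : ℝ} (hs : s ∈ I) :
    HasDerivWithinAt (fun t => ∫ x, (ρ t x - 1)) 0 I s := by
  obtain ⟨U, hU, C, c, hC, hc, hloc⟩ := h.exists_local_bounds hI hs
  obtain ⟨A₁, A₂, A₃, D, h0, h1, h2, h3, h4, h5, h6, hd⟩ := h.exists_derivs_inv hs
  have hsU : s ∈ I ∩ U := ⟨hs, mem_of_mem_nhds hU⟩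
  have hρ := (hloc s hsU).2.1
  have hpos : ∀ x, 0 < ρ s x := h.pos s hs
  have hne : ∀ x, ρ s x ≠ 0 := fun x => (hpos x).ne'
  have hcont := h.continuous hs
  have hval : ∫ x, 1 / 4 * (1 / ρ s x * A₃ x) = 0 := by
    rw [integral_const_mul, integral_mul_deriv_three_eq_zero h0 h1 h2 ?_ ?_ h5 h6, mul_zero]
    · refine integrable_of_norm_le_inv_one_add_sq (D := 1 / c * D) ?_ fun x => ?_
      · fun_prop (disch := assumption)
      · rw [norm_mul, Real.norm_of_nonneg (one_div_pos.2 (hpos x)).le, Real.norm_eq_abs, mul_assoc]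
        gcongr
        exacts [hρ x, h4 x]
    · simpa using (h.tendsto hs).inv₀ one_ne_zero
  have hdρ : ∀ x, HasDerivWithinAt (fun t => ρ t x) (1 / 4 * (1 / ρ s x * A₃ x)) I s := fun x => by
    have hsq : ∀ t ∈ I, ρ t x = √(ρ t x ^ 2) := fun t ht => (Real.sqrt_sq (h.pos t ht x).le).symm
    refine (((hd x).sqrt (pow_ne_zero 2 (hne x))).congr hsq (hsq s hs)).congr_deriv ?_
    rw [Real.sqrt_sq (hpos x).le]
    have := hne x
    field_simp
    norm_num [mul_comm]
  rw [← hasDerivWithinAt_inter hU, hasDerivWithinAt_iff_tendsto_slope, ← hval]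
  have hmem : ∀ᶠ t in 𝓝[(I ∩ U) \ {s}] s, t ∈ (I ∩ U) \ {s} := self_mem_nhdsWithin
  have hslope : ∀ t ∈ I, slope (fun t => ∫ x, (ρ t x - 1)) s t =
      ∫ x, slope (fun t => ρ t x) s t := fun t ht => by
    rw [slope_def_module, ← integral_sub (h.integrable ht) (h.integrable hs), ← integral_smul]
    congr 1 with x
    rw [slope_def_module, sub_sub_sub_cancel_right]
  refine Tendsto.congr' (hmem.mono fun t ht => (hslope t ht.1.1).symm) ?_
  refine tendsto_integral_filter_of_dominated_convergence
    (fun x => c⁻¹ * C * (1 + x ^ 2)⁻¹) ?_ ?_ (integrable_inv_one_add_sq.const_mul _) ?_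
  · refine hmem.mono fun t ht => Continuous.aestronglyMeasurable ?_
    have := h.continuous ht.1.1
    simp only [slope_def_module, smul_eq_mul]
    fun_prop
  · refine hmem.mono fun t ht => ae_of_all _ fun x => ?_
    have hts : 0 < |t - s| := abs_pos.2 (sub_ne_zero.2 ht.2)
    have b := (hloc t ht.1).2.2 x
    have p1 := (hloc t ht.1).2.1 x
    have p2 := hpos x
    -- Since ρ(t) + ρ(s) ≥ c, the Lipschitz bound passes from ρ² to ρ at the cost of c⁻¹.
    have e : ρ t x ^ 2 - ρ s x ^ 2 = (ρ t x - ρ s x) * (ρ t x + ρ s x) := by ring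
    rw [e, abs_mul, abs_of_pos (by linarith : 0 < ρ t x + ρ s x)] at b
    have b' : |ρ t x - ρ s x| * c ≤ C * |t - s| * (1 + x ^ 2)⁻¹ := by
      refine le_trans ?_ b
      gcongr
      linarith
    rw [slope_def_module, smul_eq_mul, norm_mul, norm_inv, Real.norm_eq_abs, Real.norm_eq_abs,
      inv_mul_le_iff₀ hts]
    calc _ ≤ C * |t - s| * (1 + x ^ 2)⁻¹ / c := (le_div_iff₀ hc).2 b'
      _ = _ := by ring
  · refine ae_of_all _ fun x => ?_
    exact hasDerivWithinAt_iff_tendsto_slope.1 ((hdρ x).mono inter_subset_left)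

theorem tendsto_travelTime_sub_atTop {ρ : ℝ → ℝ} (h : Integrable fun x => ρ x - 1) :
    Tendsto (fun x => travelTime ρ x - x) atTop (𝓝 (∫ x, (ρ x - 1))) := by
  simp only [travelTime, add_sub_cancel_left]
  exact (aecover_Iic tendsto_id).integral_tendsto_of_countably_generated h

theorem tendsto_travelTime_sub_atBot {ρ : ℝ → ℝ} (h : Integrable fun x => ρ x - 1) :
    Tendsto (fun x => travelTime ρ x - x) atBot (𝓝 0) := by
  have h1 := ((aecover_Ioi (μ := volume) (α := ℝ)
    tendsto_id).integral_tendsto_of_countably_generated h).const_sub (∫ x, (ρ x - 1))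
  rw [sub_self] at h1
  refine h1.congr fun x => ?_
  simp only [travelTime, add_sub_cancel_left]
  rw [← intervalIntegral.integral_Iic_add_Ioi (b := x) h.integrableOn h.integrableOn]
  simp

/-! ### The wave functions in terms of the Jost solutions -/

theorem eq_zero_of_tendsto_atTop {ρ : ℝ → ℝ} (hρ : Continuous ρ) {C : ℝ}
    (hC : ∀ x, |1 - ρ x ^ 2| ≤ C * (1 + x ^ 2)⁻¹) {k : ℂ} (hk : 0 ≤ k.im) (hk0 : k ≠ 0)
    {d : ℝ → ℂ} (hd : IsSolution ρ k d)
    (h0 : Tendsto (fun x : ℝ => Complex.exp (-(Complex.I * k * x)) * d x) atTop (𝓝 0)) (x : ℝ) :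
    d x = 0 := by
  have hC0 : 0 ≤ C := by have := (abs_nonneg _).trans (hC 0); simpa using this
  obtain ⟨B, -, J, hJ⟩ := exists_jostRight hk hk0 hC0
  refine (hJ ρ hρ hC).1.eq_zero_of_tendsto hk (K := 1 + C) (fun y => ?_) hd h0 x
  have := (hC y).trans (mul_le_of_le_one_right hC0 (inv_one_add_sq_le_one y))
  linarith [(abs_le.1 this).1]

theorem eq_zero_of_tendsto_atBot {ρ : ℝ → ℝ} (hρ : Continuous ρ) {C : ℝ}
    (hC : ∀ x, |1 - ρ x ^ 2| ≤ C * (1 + x ^ 2)⁻¹) {k : ℂ} (hk : 0 ≤ k.im) (hk0 : k ≠ 0)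
    {d : ℝ → ℂ} (hd : IsSolution ρ k d)
    (h0 : Tendsto (fun x : ℝ => Complex.exp (Complex.I * k * x) * d x) atBot (𝓝 0)) (x : ℝ) :
    d x = 0 := by
  have hd' : IsSolution (fun y => ρ (-y)) k (fun y => d (-y)) :=
    IsSolution.comp_neg (by simpa using hd)
  have := eq_zero_of_tendsto_atTop (ρ := fun y => ρ (-y)) (by fun_prop) (C := C)
    (fun y => by simpa using hC (-y)) hk hk0 hd'
    (by simpa [Function.comp_def] using h0.comp tendsto_neg_atTop_atBot) (-x)
  simpa using this

theorem tendsto_cexp_travelTime {ρ : ℝ → ℝ} {l : Filter ℝ} {M : ℝ}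
    (h : Tendsto (fun x => travelTime ρ x - x) l (𝓝 M)) (c : ℂ) :
    Tendsto (fun x => Complex.exp (c * ((travelTime ρ x - x : ℝ) : ℂ))) l
      (𝓝 (Complex.exp (c * M))) :=
  ((Complex.continuous_exp.comp (continuous_const.mul Complex.continuous_ofReal)).tendsto M).comp h

theorem isPhiPlus_iff {ρ : ℝ → ℝ} (hρ : Continuous ρ) {C : ℝ}
    (hC : ∀ x, |1 - ρ x ^ 2| ≤ C * (1 + x ^ 2)⁻¹) (hi : Integrable fun x => ρ x - 1)
    {k : ℂ} (hk : 0 ≤ k.im) (hk0 : k ≠ 0) {B : ℝ} {φ₀ : ℝ → ℂ} (h₀ : IsJostLeft ρ k B φ₀)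
    {φ : ℝ → ℂ} : IsPhiPlus ρ k φ ↔ φ = φ₀ := by
  have key := tendsto_cexp_travelTime (tendsto_travelTime_sub_atBot hi)
  constructor
  · rintro ⟨h1, h2⟩
    have h3 := ((key (-(Complex.I * k))).mul h2).sub h₀.tendsto
    simp only [Complex.ofReal_zero, mul_zero, Complex.exp_zero, one_mul, sub_self] at h3
    funext x
    refine sub_eq_zero.1 (eq_zero_of_tendsto_atBot hρ hC hk hk0 (h1.sub h₀.sol)
      (h3.congr fun y => ?_) x)
    rw [← mul_assoc, ← Complex.exp_add, mul_sub]
    push_cast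
    ring_nf
  · rintro rfl
    refine ⟨h₀.sol, ?_⟩
    have h3 := (key (Complex.I * k)).mul h₀.tendsto
    simp only [Complex.ofReal_zero, mul_zero, Complex.exp_zero, one_mul] at h3
    refine h3.congr fun y => ?_
    rw [← mul_assoc, ← Complex.exp_add]
    push_cast
    ring_nf

theorem isPsiPlus_iff {ρ : ℝ → ℝ} (hρ : Continuous ρ) {C : ℝ}
    (hC : ∀ x, |1 - ρ x ^ 2| ≤ C * (1 + x ^ 2)⁻¹) (hi : Integrable fun x => ρ x - 1)
    {k : ℂ} (hk : 0 ≤ k.im) (hk0 : k ≠ 0) {B : ℝ} {ψ₀ : ℝ → ℂ} (h₀ : IsJostRight ρ k B ψ₀)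
    {ψ : ℝ → ℂ} : IsPsiPlus ρ k ψ ↔
      ψ = fun x => Complex.exp (Complex.I * k * ((∫ x, (ρ x - 1) : ℝ) : ℂ)) * ψ₀ x := by
  have key := tendsto_cexp_travelTime (tendsto_travelTime_sub_atTop hi)
  set M := ∫ x, (ρ x - 1) with hM
  constructor
  · rintro ⟨h1, h2⟩
    have h3 := ((key (Complex.I * k)).mul h2).sub
      (h₀.tendsto.const_mul (Complex.exp (Complex.I * k * M)))
    simp only [mul_one, sub_self] at h3
    funext x
    refine sub_eq_zero.1 (eq_zero_of_tendsto_atTop hρ hC hk hk0 (h1.sub (h₀.sol.const_mul _))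
      (h3.congr fun y => ?_) x)
    rw [← mul_assoc, ← Complex.exp_add, mul_sub]
    push_cast
    ring_nf
  · rintro rfl
    refine ⟨h₀.sol.const_mul _, ?_⟩
    have h3 := ((key (-(Complex.I * k))).mul h₀.tendsto).const_mul (Complex.exp (Complex.I * k * M))
    rw [neg_mul, mul_one, ← Complex.exp_add, add_neg_cancel, Complex.exp_zero] at h3
    refine h3.congr fun y => ?_
    have e : Complex.exp (-(Complex.I * k * (travelTime ρ y : ℂ))) =
        Complex.exp (-(Complex.I * k) * ((travelTime ρ y - y : ℝ) : ℂ)) *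
          Complex.exp (-(Complex.I * k * y)) := by
      rw [← Complex.exp_add]; push_cast; ring_nf
    rw [e]
    ring

/-- For real k the frequency -k still lies in the closed upper half plane, so the theory of ψ₊
covers ψ₋. -/
theorem isPsiMinus_iff_neg {ρ : ℝ → ℝ} {k : ℂ} {ψ : ℝ → ℂ} :
    IsPsiMinus ρ k ψ ↔ IsPsiPlus ρ (-k) ψ := by
  simp [IsPsiMinus, IsPsiPlus, IsSolution]

theorem wronskian_const_mul_right (c : ℂ) (f : ℝ → ℂ) {g : ℝ → ℂ} (hg : Differentiable ℝ g)
    (x : ℝ) : wronskian f (fun y => c * g y) x = c * wronskian f g x := by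
  simp only [wronskian, ((hg x).hasDerivAt.const_mul c).deriv]
  ring

theorem wronskian_jostRight_neg {ρ : ℝ → ℝ} {k : ℂ} {B B' : ℝ} {ψ χ : ℝ → ℂ}
    (hψ : IsJostRight ρ k B ψ) (hχ : IsJostRight ρ (-k) B' χ) (x : ℝ) :
    wronskian ψ χ x = -(2 * Complex.I * k) := by
  have h := (hψ.tendsto.mul hχ.tendsto_deriv).sub (hψ.tendsto_deriv.mul hχ.tendsto)
  have h' : Tendsto (fun _ : ℝ => wronskian ψ χ x) atTop
      (𝓝 (1 * (Complex.I * -k) - Complex.I * k * 1)) := by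
    refine h.congr fun y => ?_
    have e : Complex.exp (-(Complex.I * k * y)) * Complex.exp (-(Complex.I * -k * y)) = 1 := by
      rw [← Complex.exp_add]; simp
    rw [wronskian_eq hψ.sol (hχ.sol.of_sq_eq (by ring)) x y, wronskian]
    linear_combination (ψ y * deriv χ y - deriv ψ y * χ y) * e
  rw [tendsto_nhds_unique tendsto_const_nhds h']
  ring

/-- Cramer's rule in the basis ψ, χ, whose Wronskian is -2ik. The phases p and q of ψ₊ and ψ₋ are
inverse to each other, so 1/q = p enters a and 1/p = q enters b. -/
theorem isScatteringData_iff {ρ : ℝ → ℝ} (hρ : Continuous ρ) {C : ℝ}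
    (hC : ∀ x, |1 - ρ x ^ 2| ≤ C * (1 + x ^ 2)⁻¹) (hi : Integrable fun x => ρ x - 1)
    {k : ℝ} (hk0 : k ≠ 0) {B B₁ B₂ : ℝ} {φ ψ χ : ℝ → ℂ} (hφ : IsJostLeft ρ k B φ)
    (hψ : IsJostRight ρ k B₁ ψ) (hχ : IsJostRight ρ (-k) B₂ χ) {α β : ℂ} :
    IsScatteringData ρ k α β ↔
      α = Complex.exp (Complex.I * k * ((∫ x, (ρ x - 1) : ℝ) : ℂ)) * wronskian φ ψ 0 /
        (2 * Complex.I * k) ∧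
      β = Complex.exp (Complex.I * (-k) * ((∫ x, (ρ x - 1) : ℝ) : ℂ)) * wronskian φ χ 0 /
        -(2 * Complex.I * k) := by
  have hk' : (k : ℂ) ≠ 0 := by exact_mod_cast hk0
  have h2k : 2 * Complex.I * (k : ℂ) ≠ 0 :=
    mul_ne_zero (mul_ne_zero two_ne_zero Complex.I_ne_zero) hk'
  have hd := hψ.sol.1
  have iφ : ∀ {f}, IsPhiPlus ρ k f ↔ f = φ := isPhiPlus_iff hρ hC hi (by simp) hk' hφ
  have iψ : ∀ {f}, IsPsiPlus ρ k f ↔ f = _ := isPsiPlus_iff hρ hC hi (by simp) hk' hψ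
  have iχ : ∀ {f}, IsPsiMinus ρ k f ↔ f = _ := fun {f} => isPsiMinus_iff_neg.trans
    (isPsiPlus_iff hρ hC hi (by simp) (neg_ne_zero.2 hk') hχ)
  set p := Complex.exp (Complex.I * k * ((∫ x, (ρ x - 1) : ℝ) : ℂ)) with hp
  set q := Complex.exp (Complex.I * (-k) * ((∫ x, (ρ x - 1) : ℝ) : ℂ)) with hq
  have hpq : p * q = 1 := by rw [hp, hq, ← Complex.exp_add]; ring_nf; simp
  have e1 : ∀ x, φ x * deriv ψ x - deriv φ x * ψ x = wronskian φ ψ 0 :=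
    fun x => wronskian_eq hφ.sol hψ.sol x 0
  have e2 : ∀ x, φ x * deriv χ x - deriv φ x * χ x = wronskian φ χ 0 :=
    fun x => wronskian_eq hφ.sol (hχ.sol.of_sq_eq (by ring)) x 0
  have e3 : ∀ x, ψ x * deriv χ x - deriv ψ x * χ x = -(2 * Complex.I * k) :=
    fun x => wronskian_jostRight_neg hψ hχ x
  constructor
  · rintro (⟨h, -⟩ | ⟨-, f, g, m, hf, hg, hm, hx⟩)
    · exact absurd h hk0
    rw [iφ.1 hf, iψ.1 hg, iχ.1 hm] at hx
    have hx' : ∀ x, deriv φ x = α * (q * deriv χ x) + β * (p * deriv ψ x) := fun x => by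
      rw [show φ = fun x => α * (q * χ x) + β * (p * ψ x) from funext hx]
      exact ((((hχ.sol.hasDerivAt x).const_mul q).const_mul α).add
        (((hψ.sol.hasDerivAt x).const_mul p).const_mul β)).deriv
    rw [eq_div_iff h2k, eq_div_iff (neg_ne_zero.2 h2k), ← e1 0, ← e2 0, hx 0, hx' 0]
    constructor
    · linear_combination α * (p * q) * e3 0 - 2 * Complex.I * k * α * hpq
    · linear_combination -β * (p * q) * e3 0 + 2 * Complex.I * k * β * hpq
  · rintro ⟨rfl, rfl⟩
    refine Or.inr ⟨hk0, _, _, _, iφ.2 rfl, iψ.2 rfl, iχ.2 rfl, fun x => ?_⟩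
    -- The three-term identity W(ψ, χ)φ = -W(φ, ψ)χ + W(φ, χ)ψ.
    have h4 : -(2 * Complex.I * k) * φ x =
        (-wronskian φ ψ 0 * χ x + wronskian φ χ 0 * ψ x) := by
      rw [← e1 x, ← e2 x, ← e3 x]; ring
    have h5 : φ x = (wronskian φ ψ 0 * χ x - wronskian φ χ 0 * ψ x) / (2 * Complex.I * k) := by
      rw [eq_div_iff h2k]; linear_combination -h4
    rw [h5, div_neg]
    linear_combination (-(wronskian φ ψ 0 * χ x - wronskian φ χ 0 * ψ x) /
      (2 * Complex.I * k)) * hpq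

theorem isExtendedA_iff {ρ : ℝ → ℝ} (hρ : Continuous ρ) {C : ℝ}
    (hC : ∀ x, |1 - ρ x ^ 2| ≤ C * (1 + x ^ 2)⁻¹) (hi : Integrable fun x => ρ x - 1)
    {k : ℂ} (hk : 0 ≤ k.im) (hk0 : k ≠ 0) {B B₁ : ℝ} {φ ψ : ℝ → ℂ} (hφ : IsJostLeft ρ k B φ)
    (hψ : IsJostRight ρ k B₁ ψ) {α : ℂ} :
    IsExtendedA ρ k α ↔ α = Complex.exp (Complex.I * k * ((∫ x, (ρ x - 1) : ℝ) : ℂ)) *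
      wronskian φ ψ 0 / (2 * Complex.I * k) := by
  have h2k : 2 * Complex.I * k ≠ 0 :=
    mul_ne_zero (mul_ne_zero two_ne_zero Complex.I_ne_zero) hk0
  rw [eq_div_iff h2k, ← wronskian_const_mul_right _ _ hψ.sol.1]
  constructor
  · rintro ⟨f, g, hf, hg, h⟩
    rw [(isPhiPlus_iff hρ hC hi hk hk0 hφ).1 hf, (isPsiPlus_iff hρ hC hi hk hk0 hψ).1 hg] at h
    rw [mul_comm, ← h 0, wronskian]
  · intro h
    refine ⟨_, _, (isPhiPlus_iff hρ hC hi hk hk0 hφ).2 rfl,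
      (isPsiPlus_iff hρ hC hi hk hk0 hψ).2 rfl, fun x => ?_⟩
    rw [mul_comm _ α, h]
    exact wronskian_eq hφ.sol (hψ.sol.const_mul _) x 0

/-! ### Evolution of the scattering data -/

theorem IsJostLeft.mono {ρ : ℝ → ℝ} {k : ℂ} {B B' : ℝ} {φ : ℝ → ℂ} (h : IsJostLeft ρ k B φ)
    (hB : B ≤ B') : IsJostLeft ρ k B' φ :=
  ⟨h.sol, h.tendsto, h.tendsto_deriv, fun x => (h.bound x).trans hB,
    fun x => (h.bound_deriv x).trans hB⟩

theorem IsJostRight.mono {ρ : ℝ → ℝ} {k : ℂ} {B B' : ℝ} {ψ : ℝ → ℂ} (h : IsJostRight ρ k B ψ)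
    (hB : B ≤ B') : IsJostRight ρ k B' ψ :=
  ⟨h.sol, h.tendsto, h.tendsto_deriv, fun x => (h.bound x).trans hB,
    fun x => (h.bound_deriv x).trans hB⟩

theorem IsJostLeft.unique {ρ : ℝ → ℝ} (hρ : Continuous ρ) {C : ℝ}
    (hC : ∀ x, |1 - ρ x ^ 2| ≤ C * (1 + x ^ 2)⁻¹) {k : ℂ} (hk : 0 ≤ k.im) (hk0 : k ≠ 0)
    {B₁ B₂ : ℝ} {φ₁ φ₂ : ℝ → ℂ} (h₁ : IsJostLeft ρ k B₁ φ₁) (h₂ : IsJostLeft ρ k B₂ φ₂) :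
    φ₁ = φ₂ :=
  funext fun x => sub_eq_zero.1 (eq_zero_of_tendsto_atBot hρ hC hk hk0 (h₁.sol.sub h₂.sol)
    (by simpa [mul_sub] using h₁.tendsto.sub h₂.tendsto) x)

theorem IsJostRight.unique {ρ : ℝ → ℝ} (hρ : Continuous ρ) {C : ℝ}
    (hC : ∀ x, |1 - ρ x ^ 2| ≤ C * (1 + x ^ 2)⁻¹) {k : ℂ} (hk : 0 ≤ k.im) (hk0 : k ≠ 0)
    {B₁ B₂ : ℝ} {ψ₁ ψ₂ : ℝ → ℂ} (h₁ : IsJostRight ρ k B₁ ψ₁) (h₂ : IsJostRight ρ k B₂ ψ₂) :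
    ψ₁ = ψ₂ :=
  funext fun x => sub_eq_zero.1 (eq_zero_of_tendsto_atTop hρ hC hk hk0 (h₁.sol.sub h₂.sol)
    (by simpa [mul_sub] using h₁.tendsto.sub h₂.tendsto) x)

theorem IsHarryDymFlow.exists_abs_one_sub_sq_le {I : Set ℝ} (hI : I.OrdConnected)
    {ρ : ℝ → ℝ → ℝ} (h : IsHarryDymFlow I ρ) {t : ℝ} (ht : t ∈ I) :
    ∃ C, 0 ≤ C ∧ ∀ x, |1 - ρ t x ^ 2| ≤ C * (1 + x ^ 2)⁻¹ := by
  obtain ⟨U, hU, C, c, hC, -, hloc⟩ := h.exists_local_bounds hI ht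
  exact ⟨C, hC, (hloc t ⟨ht, mem_of_mem_nhds hU⟩).1⟩

theorem IsHarryDymFlow.exists_jostLeft {I : Set ℝ} (hI : I.OrdConnected) {ρ : ℝ → ℝ → ℝ}
    (h : IsHarryDymFlow I ρ) {k : ℂ} (hk : 0 ≤ k.im) (hk0 : k ≠ 0) {t : ℝ} (ht : t ∈ I) :
    ∃ B φ, IsJostLeft (ρ t) k B φ := by
  obtain ⟨C, hC, hb⟩ := h.exists_abs_one_sub_sq_le hI ht
  obtain ⟨B, -, J, hJ⟩ := Acoustic.exists_jostLeft hk hk0 hC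
  exact ⟨B, _, (hJ _ (h.continuous ht) hb).1⟩

theorem IsHarryDymFlow.exists_jostRight {I : Set ℝ} (hI : I.OrdConnected) {ρ : ℝ → ℝ → ℝ}
    (h : IsHarryDymFlow I ρ) {k : ℂ} (hk : 0 ≤ k.im) (hk0 : k ≠ 0) {t : ℝ} (ht : t ∈ I) :
    ∃ B ψ, IsJostRight (ρ t) k B ψ := by
  obtain ⟨C, hC, hb⟩ := h.exists_abs_one_sub_sq_le hI ht
  obtain ⟨B, -, J, hJ⟩ := Acoustic.exists_jostRight hk hk0 hC
  exact ⟨B, _, (hJ _ (h.continuous ht) hb).1⟩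

theorem IsHarryDymFlow.hasDerivWithinAt_wronskian_jost {I : Set ℝ} (hI : I.OrdConnected)
    {ρ : ℝ → ℝ → ℝ} (h : IsHarryDymFlow I ρ) {k κ : ℂ} (hk : 0 ≤ k.im) (hk0 : k ≠ 0)
    (hsq : κ ^ 2 = k ^ 2) (him : κ.im = k.im) {B₁ B₂ : ℝ → ℝ} {φ ψ : ℝ → ℝ → ℂ}
    (hφ : ∀ t ∈ I, IsJostLeft (ρ t) k (B₁ t) (φ t))
    (hψ : ∀ t ∈ I, IsJostRight (ρ t) κ (B₂ t) (ψ t)) {s : ℝ} (hs : s ∈ I) :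
    HasDerivWithinAt (fun t => wronskian (φ t) (ψ t) 0)
      (Complex.I * k ^ 2 * (k - κ) * wronskian (φ s) (ψ s) 0) I s := by
  have hκ : 0 ≤ κ.im := him ▸ hk
  have hκ0 : κ ≠ 0 := by
    rintro rfl
    exact pow_ne_zero 2 hk0 (by rw [← hsq]; ring)
  obtain ⟨U, hU, C, c, hC, hc, hloc⟩ := h.exists_local_bounds hI hs
  obtain ⟨A₁, A₂, A₃, D, h0, h1, h2, h3, h4, h5, h6, hd⟩ := h.exists_derivs_inv hs
  obtain ⟨B, -, J, hJ⟩ := Acoustic.exists_jostLeft hk hk0 hC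
  obtain ⟨B', -, J', hJ'⟩ := Acoustic.exists_jostRight hκ hκ0 hC
  have hsU : s ∈ I ∩ U := ⟨hs, mem_of_mem_nhds hU⟩
  -- The given Jost solutions may carry bounds that vary with t. Uniqueness identifies them near s
  -- with the family `J`, which has one bound and is Lipschitz in ρ².
  have eφ : ∀ t ∈ I ∩ U, φ t = J (ρ t) := fun t ht =>
    (hφ t ht.1).unique (h.continuous ht.1) (hloc t ht).1 hk hk0
      (hJ _ (h.continuous ht.1) (hloc t ht).1).1
  have eψ : ∀ t ∈ I ∩ U, ψ t = J' (ρ t) := fun t ht =>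
    (hψ t ht.1).unique (h.continuous ht.1) (hloc t ht).1 hκ hκ0
      (hJ' _ (h.continuous ht.1) (hloc t ht).1).1
  rw [← hasDerivWithinAt_inter hU]
  refine hasDerivWithinAt_wronskian (B := max B B') hsU (fun t ht => h.continuous ht.1)
    (fun t ht => (hloc t ht).2.2) (fun x => (h.pos s hs x).ne') (fun _ => rfl) h0 h1 h2 h3 h4
    (h.tendsto hs) h5 h6 (fun x => (hd x).mono inter_subset_left) hsq him
    (fun t ht => ?_) (fun t ht => ?_) (fun t ht x => ?_)
  · rw [eφ t ht]
    exact (hJ _ (h.continuous ht.1) (hloc t ht).1).1.mono (le_max_left _ _)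
  · rw [eψ t ht]
    exact (hJ' _ (h.continuous ht.1) (hloc t ht).1).1.mono (le_max_right _ _)
  · rw [eφ t ht, eφ s hsU]
    refine ((hJ _ (h.continuous ht.1) (hloc t ht).1).2 _ (h.continuous hs) (hloc s hsU).1 _
      (hloc t ht).2.2 x).trans ?_
    gcongr
    exact le_max_left _ _

/-- By conservation of ∫ (ρ - 1) the phase behaves as a constant, so a and b inherit the linear laws
of the Wronskians. -/
theorem IsHarryDymFlow.hasDerivWithinAt_normalized {I : Set ℝ} (hI : I.OrdConnected)
    {ρ : ℝ → ℝ → ℝ} (h : IsHarryDymFlow I ρ) {s : ℝ} (hs : s ∈ I) (c e : ℂ) {w : ℝ → ℂ} {w' : ℂ}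
    (hw : HasDerivWithinAt w w' I s) :
    HasDerivWithinAt (fun t => Complex.exp (c * ((∫ x, (ρ t x - 1) : ℝ) : ℂ)) * w t / e)
      (Complex.exp (c * ((∫ x, (ρ s x - 1) : ℝ) : ℂ)) * w' / e) I s :=
  (((((h.hasDerivWithinAt_integral hI hs).ofReal_comp.const_mul c).cexp).mul hw).div_const
    e).congr_deriv (by simp)

end Acoustic

end

theorem theorem4p1 (I : Set ℝ) (hI : I.OrdConnected) (ρ : ℝ → ℝ → ℝ)
    (hρ : Acoustic.IsHarryDymFlow I ρ) :
    (∀ k : ℝ, ∃ a b : ℝ → ℂ,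
      (∀ t ∈ I, ∀ α β : ℂ,
        Acoustic.IsScatteringData (ρ t) k α β ↔ α = a t ∧ β = b t) ∧
      ∀ t ∈ I, HasDerivWithinAt a 0 I t ∧
        HasDerivWithinAt b (2 * Complex.I * (k : ℂ) ^ 3 * b t) I t) ∧
    (∀ k : ℂ, 0 < k.im → ∃ a : ℝ → ℂ,
      (∀ t ∈ I, ∀ α : ℂ, Acoustic.IsExtendedA (ρ t) k α ↔ α = a t) ∧
      ∀ t ∈ I, HasDerivWithinAt a 0 I t) := by
  have left : ∀ {k : ℂ}, 0 ≤ k.im → k ≠ 0 → ∃ (B : ℝ → ℝ) (φ : ℝ → ℝ → ℂ),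
      ∀ t ∈ I, Acoustic.IsJostLeft (ρ t) k (B t) (φ t) := fun hk hk0 => by
    choose! B φ h using fun t ht => hρ.exists_jostLeft hI hk hk0 (t := t) ht
    exact ⟨B, φ, h⟩
  have right : ∀ {k : ℂ}, 0 ≤ k.im → k ≠ 0 → ∃ (B : ℝ → ℝ) (φ : ℝ → ℝ → ℂ),
      ∀ t ∈ I, Acoustic.IsJostRight (ρ t) k (B t) (φ t) := fun hk hk0 => by
    choose! B φ h using fun t ht => hρ.exists_jostRight hI hk hk0 (t := t) ht
    exact ⟨B, φ, h⟩
  refine ⟨fun k => ?_, fun k hk => ?_⟩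
  · rcases eq_or_ne k 0 with rfl | hk0
    · refine ⟨fun _ => 1, fun _ => 0, fun t _ α β => ?_, fun t _ => ⟨?_, ?_⟩⟩
      · simp [Acoustic.IsScatteringData]
      · exact hasDerivWithinAt_const _ _ _
      · simpa using hasDerivWithinAt_const t I (0 : ℂ)
    have hk' : (k : ℂ) ≠ 0 := by exact_mod_cast hk0
    have him : 0 ≤ (k : ℂ).im := by simp
    obtain ⟨B, φ, hφ⟩ := left him hk'
    obtain ⟨B₁, ψ, hψ⟩ := right him hk'
    obtain ⟨B₂, χ, hχ⟩ := right (k := -(k : ℂ)) (by simp) (neg_ne_zero.2 hk')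
    refine ⟨fun t => Complex.exp (Complex.I * k * ((∫ x, (ρ t x - 1) : ℝ) : ℂ)) *
        Acoustic.wronskian (φ t) (ψ t) 0 / (2 * Complex.I * k),
      fun t => Complex.exp (Complex.I * (-k) * ((∫ x, (ρ t x - 1) : ℝ) : ℂ)) *
        Acoustic.wronskian (φ t) (χ t) 0 / -(2 * Complex.I * k),
      fun t ht α β => ?_, fun t ht => ⟨?_, ?_⟩⟩
    · obtain ⟨C, -, hC⟩ := hρ.exists_abs_one_sub_sq_le hI ht
      exact Acoustic.isScatteringData_iff (hρ.continuous ht) hC (hρ.integrable ht) hk0 (hφ t ht)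
        (hψ t ht) (hχ t ht)
    · have hw := hρ.hasDerivWithinAt_wronskian_jost hI him hk' rfl rfl hφ hψ ht
      exact (hρ.hasDerivWithinAt_normalized hI ht _ _ hw).congr_deriv (by simp)
    -- Here κ = -k, so the rate ik²(k - κ) equals 2ik³.
    · have hw := hρ.hasDerivWithinAt_wronskian_jost hI him hk' (by ring) (by simp) hφ hχ ht
      exact (hρ.hasDerivWithinAt_normalized hI ht _ _ hw).congr_deriv (by ring)
  · have hk0 : k ≠ 0 := by
      rintro rfl
      simp at hk
    obtain ⟨B, φ, hφ⟩ := left hk.le hk0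
    obtain ⟨B₁, ψ, hψ⟩ := right hk.le hk0
    refine ⟨fun t => Complex.exp (Complex.I * k * ((∫ x, (ρ t x - 1) : ℝ) : ℂ)) *
        Acoustic.wronskian (φ t) (ψ t) 0 / (2 * Complex.I * k),
      fun t ht α => ?_, fun t ht => ?_⟩
    · obtain ⟨C, -, hC⟩ := hρ.exists_abs_one_sub_sq_le hI ht
      exact Acoustic.isExtendedA_iff (hρ.continuous ht) hC (hρ.integrable ht) hk.le hk0 (hφ t ht)
        (hψ t ht)
    · have hw := hρ.hasDerivWithinAt_wronskian_jost hI hk.le hk0 rfl rfl hφ hψ ht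
      exact (hρ.hasDerivWithinAt_normalized hI ht _ _ hw).congr_deriv (by simp)
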